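/- Let $0<p<1/2$. Let $\mathbb D$ be the unit disk and $\partial\mathbb D$ the unit circle, with $|\cdot|$ denoting arc length on $\partial\mathbb D$. For a finite positive Borel measure $\mu$ on $\partial\mathbb D$ put $$S_\mu(z)=\exp\Bigl(-\int_{\partial\mathbb D}\frac{\zeta+z}{\zeta-z}\,d\mu(\zeta)\Bigr),\qquad |z|<1.$$ We say that $S_\mu$ satisfies the $(1+p)$-area condition if for every $0<c<1$ $$\int_{\{z\in\mathbb D:\,|S_\mu(z)|<c\}}\frac{dA(z)}{(1-|z|)^{1+p}}<\infty .$$ A $(1-p)$-Beurling–Carleson set is a closed set $E\subset\partial\mathbb D$ of zero length whose complementary arcs $\{J\}$ (the connected components of $\partial\mathbb D\setminus E$) satisfy $\sum_J|J|^{1-p}<\infty$. The Hardy space $H^p$ consists of the analytic functions $f$ on $\mathbb D$ with $\sup_{0\le r<1}\int_{0}^{2\pi}|f(re^{i\theta})|^p\,d\theta<\infty$. (a) If a finite positive measure $\mu$ is supported on a $(1-p)$-Beurling–Carleson set $E$ (that is, $\mu(\partial\mathbb D\setminus E)=0$) and $S_\mu$ satisfies the $(1+p)$-area condition, then $S_\mu'\in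 H^p$. (b) Let $\mu$ be a finite positive measure on $\partial\mathbb D$ that is singular with respect to arc length. Then $\mu$ can be written as a countable sum $\mu=\sum_k\mu_k$ of finite positive measures such that every $S_{\mu_k}$ satisfies the $(1+p)$-area condition if and only if $\mu$ can be written as a countable sum $\mu=\sum_k\mu_k$ of finite positive measures such that $S_{\mu_k}'\in H^p$ for every $k$. -/

import Mathlib

open MeasureTheory Set
open scoped ENNReal

noncomputable section

/-- The Borel `σ`-algebra of the unit circle. -/
instance circleMeasurableSpace : MeasurableSpace Circle := borel Circle

instance circleBorelSpace : BorelSpace Circle := ⟨rfl⟩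

/-- Arc length on the unit circle (total mass `2π`). -/
def circleArcLength : Measure Circle :=
  Measure.map Circle.exp (volume.restrict (Ioc (-Real.pi) Real.pi))

/-- The complementary arcs of `E`: the connected components of the complement of `E`. -/
def complementaryArcs (E : Set Circle) : Set (Set Circle) :=
  {J | ∃ x ∈ Eᶜ, J = connectedComponentIn Eᶜ x}

/-- `α`-Beurling–Carleson sets: closed sets of zero length whose complementary arcs `J`
satisfy `∑ |J| ^ α < ∞`. -/
structure IsBeurlingCarleson (α : ℝ) (E : Set Circle) : Prop where
  isClosed : IsClosed E
  length_eq_zero : circleArcLength E = 0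
  sum_lt_top : ∑' J : complementaryArcs E, circleArcLength J.1 ^ α < ∞

/-- The singular inner function `S_μ(z) = exp (-∫ (ζ + z) / (ζ - z) dμ(ζ))`, `|z| < 1`. -/
def singularInner (μ : Measure Circle) (z : ℂ) : ℂ :=
  Complex.exp (-∫ ζ : Circle, ((ζ : ℂ) + z) / ((ζ : ℂ) - z) ∂μ)

/-- `S_μ` satisfies the `s`-area condition: for every `0 < c < 1`, the integral of
`(1 - |z|) ^ (-s)` over `{z ∈ 𝔻 : |S_μ(z)| < c}` with respect to area is finite. -/
def AreaCondition (s : ℝ) (μ : Measure Circle) : Prop :=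
  ∀ c : ℝ, 0 < c → c < 1 →
    ∫⁻ z in {z : ℂ | ‖z‖ < 1 ∧ ‖singularInner μ z‖ < c},
      ENNReal.ofReal (1 / (1 - ‖z‖) ^ s) < ∞

/-- The Hardy space `H^p` of the unit disk, `0 < p < ∞`. -/
def MemHardy (p : ℝ) (f : ℂ → ℂ) : Prop :=
  DifferentiableOn ℂ f (Metric.ball 0 1) ∧
    ⨆ r : Ico (0 : ℝ) 1, ∫⁻ ζ : Circle, ‖f ((r : ℝ) * (ζ : ℂ))‖ₑ ^ p ∂circleArcLength < ∞

/-- `μ` satisfies `P` up to countable sums: it is a countable sum of finite positive measures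
each of which satisfies `P`. (A finite sum is padded with zero measures.) -/
def UpToCountableSums (P : Measure Circle → Prop) (μ : Measure Circle) : Prop :=
  ∃ ν : ℕ → Measure Circle,
    (∀ k, IsFiniteMeasure (ν k) ∧ P (ν k)) ∧ μ = Measure.sum ν

end

open Filter Metric
open scoped Topology Real

/-! Everything passes through the potential V(z) = ∫ |ξ - z|⁻² dμ(ξ) (`inverseSquarePotential`). The
real part of the Herglotz kernel gives |S_μ(z)| = exp(-(1 - |z|²) V(z)), and differentiating gives
|S_μ'| ≤ 2V. Since |ξ - ζ| ≤ 2|ξ - rζ| on the circle, V(rζ) ≤ 4V(ζ). Hence the boundary condition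
(*) ∫ V^p < ∞ over the circle implies S_μ' ∈ H^p, and it also implies the area condition, because
|S_μ(rζ)| < c forces 1 - r to be at least a multiple of 1/V(ζ). It remains to recover (*) in three
situations.

For (a), let d be the distance from ζ to E. If V(ζ) is much larger than 1/d, then V(rζ) is still
comparable to V(ζ) for 1 - r of size 1/V(ζ), so S_μ is small on that part of the radius and the
radial area integral at ζ is at least a multiple of V(ζ)^p. Thus V^p is bounded by d^(-p) plus the
radial area integral (`rpow_inverseSquarePotential_le`); the first is integrable exactly because E
is a Beurling–Carleson set, the second by the area condition.

For the forward half of (b), consider the closed sets where |S_μ| ≤ e⁻⁸ from a fixed radius on.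
Differentiation of measures shows that they carry all of a singular μ, and the area condition makes
them Beurling–Carleson sets: near such a set S_μ is small at height comparable to the distance.
Cutting μ along them reduces to (a).

For the converse, let S_μ' ∈ H^p with μ singular. Then |S_μ'|^p has a Poisson majorant, so S_μ' is
bounded on almost every radius, while |S_μ| → 1 there; together these force V < ∞ almost everywhere.
At such points |S_μ'(rζ)| → 2V(ζ), since on the circle the integrand of the derivative has constant
argument, and Fatou's lemma gives (*). -/

/-! ### Arc length, chords and polar coordinates. -/

/-- By periodicity the fundamental interval may start at any `t`; this lets each arc or ball be read
in a chart where it does not wrap around. -/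
theorem lintegral_circleArcLength {g : Circle → ℝ≥0∞} (hg : Measurable g) (t : ℝ) :
    ∫⁻ ζ, g ζ ∂circleArcLength = ∫⁻ θ in Ioc t (t + 2 * π), g (Circle.exp θ) := by
  have : Fact (0 < 2 * π) := ⟨by positivity⟩
  have key (s : ℝ) : ∫⁻ θ in Ioc s (s + 2 * π), g (Circle.exp θ) =
      ∫⁻ b : AddCircle (2 * π), g (AddCircle.homeomorphCircle' b) := by
    rw [← AddCircle.lintegral_preimage (2 * π) s]
    simp [AddCircle.homeomorphCircle'_apply_mk]
  rw [key, ← key (-π), circleArcLength, lintegral_map hg Circle.exp.continuous.measurable]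
  congr 3
  ring

theorem circleArcLength_apply {s : Set Circle} (hs : MeasurableSet s) (t : ℝ) :
    circleArcLength s = volume (Ioc t (t + 2 * π) ∩ Circle.exp ⁻¹' s) := by
  rw [← lintegral_indicator_one hs,
    lintegral_circleArcLength (measurable_one.indicator hs) t, inter_comm,
    ← Measure.restrict_apply (Circle.exp.continuous.measurable hs),
    ← lintegral_indicator_one (Circle.exp.continuous.measurable hs)]
  rfl

instance : IsFiniteMeasure circleArcLength := by
  constructor
  rw [circleArcLength_apply MeasurableSet.univ 0]
  simpa using ENNReal.mul_lt_top (by simp) ENNReal.ofReal_lt_top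

theorem norm_exp_sub_exp (x y : ℝ) :
    ‖(Circle.exp x : ℂ) - Circle.exp y‖ = 2 * |Real.sin ((x - y) / 2)| := by
  have h : (Circle.exp x : ℂ) - Circle.exp y =
      Circle.exp y * (Complex.exp (Complex.I * ((x - y : ℝ) : ℂ)) - 1) := by
    rw [Circle.coe_exp, Circle.coe_exp, mul_sub, ← Complex.exp_add, mul_one]
    congr 2
    push_cast
    ring
  rw [h, norm_mul, Circle.norm_coe, one_mul, Complex.norm_exp_I_mul_ofReal_sub_one]
  simp

theorem norm_exp_sub_exp_le (x y : ℝ) :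
    ‖(Circle.exp x : ℂ) - Circle.exp y‖ ≤ |x - y| := by
  rw [norm_exp_sub_exp]
  have := Real.abs_sin_le_abs (x := (x - y) / 2)
  rw [abs_div, abs_two] at this
  linarith

theorem le_norm_exp_sub_exp {x y : ℝ} (h : |x - y| ≤ π) :
    2 / π * |x - y| ≤ ‖(Circle.exp x : ℂ) - Circle.exp y‖ := by
  rw [norm_exp_sub_exp]
  have := Real.mul_abs_le_abs_sin (x := (x - y) / 2) (by rw [abs_div, abs_two]; linarith)
  rw [abs_div, abs_two] at this
  linarith

theorem Circle.dist_eq_norm (ζ ξ : Circle) : dist ζ ξ = ‖(ζ : ℂ) - ξ‖ := by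
  exact _root_.dist_eq_norm (ζ : ℂ) ξ

theorem le_circleArcLength_closedBall (ζ : Circle) {h : ℝ} (h1 : h ≤ 1) :
    ENNReal.ofReal h ≤ circleArcLength (closedBall ζ h) := by
  obtain ⟨θ, rfl⟩ := Circle.exp_surjective ζ
  rw [circleArcLength_apply measurableSet_closedBall θ]
  calc ENNReal.ofReal h = volume (Ioc θ (θ + h)) := by simp
    _ ≤ _ := by
      refine measure_mono fun x hx ↦ ⟨⟨hx.1, hx.2.trans ?_⟩, ?_⟩
      · linarith [Real.pi_gt_three]
      · rw [mem_preimage, mem_closedBall, Circle.dist_eq_norm]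
        refine (norm_exp_sub_exp_le _ _).trans ?_
        rw [abs_of_pos (by linarith [hx.1])]
        linarith [hx.2]

theorem circleArcLength_closedBall_le (ζ : Circle) (h : ℝ) :
    circleArcLength (closedBall ζ h) ≤ ENNReal.ofReal (π * h) := by
  obtain ⟨θ, rfl⟩ := Circle.exp_surjective ζ
  rw [circleArcLength_apply measurableSet_closedBall (θ - π)]
  calc _ ≤ volume (Icc (θ - π / 2 * h) (θ + π / 2 * h)) := by
        refine measure_mono fun x hx ↦ ?_
        obtain ⟨⟨h1, h2⟩, h3⟩ := hx
        rw [mem_preimage, mem_closedBall, Circle.dist_eq_norm] at h3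
        have h4 : |x - θ| ≤ π := by rw [abs_le]; constructor <;> linarith
        have h5 := (le_norm_exp_sub_exp h4).trans h3
        have h6 : |x - θ| ≤ π / 2 * h := by
          have := mul_le_mul_of_nonneg_left h5 (by positivity : (0 : ℝ) ≤ π / 2)
          have e : π / 2 * (2 / π * |x - θ|) = |x - θ| := by field_simp
          linarith
        rw [abs_le] at h6
        constructor <;> linarith [h6.1, h6.2]
    _ = ENNReal.ofReal (π * h) := by
        rw [Real.volume_Icc]
        congr 1
        ring

theorem lintegral_polar {F : ℂ → ℝ≥0∞} (hF : Measurable F) :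
    ∫⁻ z, F z = ∫⁻ ζ : Circle, (∫⁻ r in Ioi (0 : ℝ), ENNReal.ofReal r * F (r * ζ))
      ∂circleArcLength := by
  have hm : Measurable fun q : Circle × ℝ ↦ ENNReal.ofReal q.2 * F (q.2 * q.1) := by
    refine (ENNReal.measurable_ofReal.comp measurable_snd).mul (hF.comp ?_)
    fun_prop
  rw [← Complex.lintegral_comp_polarCoord_symm, polarCoord_target,
    lintegral_circleArcLength (Measurable.lintegral_prod_right hm) (-π)]
  simp_rw [Complex.polarCoord_symm_apply]
  have e (p : ℝ × ℝ) : (p.1 * (Real.cos p.2 + Real.sin p.2 * Complex.I) : ℂ) =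
      p.1 * (Circle.exp p.2 : ℂ) := by
    rw [Circle.coe_exp, Complex.exp_mul_I, Complex.ofReal_cos, Complex.ofReal_sin]
  simp_rw [e, smul_eq_mul]
  rw [Measure.volume_eq_prod, ← Measure.prod_restrict, lintegral_prod_symm']
  · have : (-π + 2 * π) = π := by ring
    rw [this, restrict_Ioo_eq_restrict_Ioc]
  · exact hm.comp ((Circle.exp.continuous.measurable.comp measurable_snd).prodMk measurable_fst)

theorem ENNReal.rpow_neg_le_rpow_neg {x y : ℝ≥0∞} {p : ℝ} (hp : 0 ≤ p) (h : x ≤ y) :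
    y ^ (-p) ≤ x ^ (-p) := by
  rw [ENNReal.rpow_neg, ENNReal.rpow_neg]
  exact ENNReal.inv_le_inv.2 (ENNReal.rpow_le_rpow h hp)

/-! ### Complementary arcs and integrability of the distance to a Beurling–Carleson set. -/

/-- The endpoints are the last angle of `E` before a point of the arc and the first angle of `E`
after it. -/
theorem exists_eq_exp_image_Ioo {E J : Set Circle} (hE : IsClosed E) (hne : E.Nonempty)
    (hJ : J ∈ complementaryArcs E) :
    ∃ a b : ℝ, a < b ∧ b ≤ a + 2 * π ∧ J = Circle.exp '' Ioo a b ∧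
      Circle.exp a ∈ E ∧ Circle.exp b ∈ E ∧ ∀ θ ∈ Ioo a b, Circle.exp θ ∉ E := by
  obtain ⟨x, hx, rfl⟩ := hJ
  obtain ⟨θ, rfl⟩ := Circle.exp_surjective x
  obtain ⟨e, he⟩ := hne
  obtain ⟨φ, rfl⟩ := Circle.exp_surjective e
  have hπ : 0 < 2 * π := by positivity
  have hF : IsClosed (Circle.exp ⁻¹' E) := hE.preimage Circle.exp.continuous
  set A := Circle.exp ⁻¹' E ∩ Icc (θ - 2 * π) θ
  set B := Circle.exp ⁻¹' E ∩ Icc θ (θ + 2 * π)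
  have hA : IsCompact A := isCompact_Icc.inter_left hF
  have hB : IsCompact B := isCompact_Icc.inter_left hF
  have hAne : A.Nonempty := by
    obtain ⟨y, hy, hy'⟩ := Circle.periodic_exp.exists_mem_Ico hπ φ (θ - 2 * π)
    refine ⟨y, ?_, hy.1, by linarith [hy.2]⟩
    rw [mem_preimage, ← hy']
    exact he
  have hBne : B.Nonempty := by
    obtain ⟨y, hy, hy'⟩ := Circle.periodic_exp.exists_mem_Ico hπ φ θ
    refine ⟨y, ?_, hy.1, by linarith [hy.2]⟩
    rw [mem_preimage, ← hy']
    exact he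
  obtain ⟨haE, ha1, ha2⟩ : sSup A ∈ A := hA.sSup_mem hAne
  obtain ⟨hbE, hb1, hb2⟩ : sInf B ∈ B := hB.sInf_mem hBne
  set a := sSup A
  set b := sInf B
  have haθ : a < θ := lt_of_le_of_ne ha2 (by rintro h; rw [h] at haE; exact hx haE)
  have hbθ : θ < b := lt_of_le_of_ne hb1 (by rintro h; rw [← h] at hbE; exact hx hbE)
  have hgap : ∀ t ∈ Ioo a b, Circle.exp t ∉ E := by
    intro t ht htE
    rcases le_total t θ with h | h
    · exact absurd (le_csSup hA.bddAbove (show t ∈ A from ⟨htE, by linarith [ht.1], h⟩))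
        (not_le.2 ht.1)
    · exact absurd (csInf_le hB.bddBelow (show t ∈ B from ⟨htE, h, by linarith [ht.2]⟩))
        (not_le.2 ht.2)
  have hθ : θ ∈ Ioo a b := ⟨haθ, hbθ⟩
  refine ⟨a, b, haθ.trans hbθ, ?_, ?_, haE, hbE, hgap⟩
  -- The angle a + 2π also lies over `E`, so it competes in the infimum defining b.
  · refine csInf_le hB.bddBelow ⟨?_, by linarith, by linarith⟩
    rw [mem_preimage, Circle.exp_add_two_pi]
    exact haE
  · apply Subset.antisymm
    -- A connected set that meets an open set and avoids its boundary stays inside it; the only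
    -- possible boundary points are the images of a and b, which lie in `E`.
    · refine isPreconnected_connectedComponentIn.subset_of_closure_inter_subset
        (isLocalHomeomorph_circleExp.isOpenMap _ isOpen_Ioo)
        ⟨_, mem_connectedComponentIn hx, θ, hθ, rfl⟩ ?_
      rintro y ⟨hy1, hy2⟩
      have hcl : closure (Circle.exp '' Ioo a b) ⊆ Circle.exp '' Icc a b :=
        closure_minimal (image_mono Ioo_subset_Icc_self)
          (isCompact_Icc.image Circle.exp.continuous).isClosed
      obtain ⟨t, ht, rfl⟩ := hcl hy1
      have hyE := connectedComponentIn_subset _ _ hy2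
      refine ⟨t, ⟨lt_of_le_of_ne ht.1 ?_, lt_of_le_of_ne ht.2 ?_⟩, rfl⟩
      · rintro rfl
        exact hyE haE
      · rintro rfl
        exact hyE hbE
    · refine (isPreconnected_Ioo.image _ Circle.exp.continuous.continuousOn).subset_connectedComponentIn
        ⟨θ, hθ, rfl⟩ ?_
      rintro _ ⟨t, ht, rfl⟩
      exact hgap t ht

theorem setLIntegral_exp_image_Ioo {a b : ℝ} (hab : b ≤ a + 2 * π) {g : Circle → ℝ≥0∞}
    (hg : Measurable g) :
    ∫⁻ ζ in Circle.exp '' Ioo a b, g ζ ∂circleArcLength =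
      ∫⁻ θ in Ioo a b, g (Circle.exp θ) := by
  have hJ : MeasurableSet (Circle.exp '' Ioo a b) :=
    (isLocalHomeomorph_circleExp.isOpenMap _ isOpen_Ioo).measurableSet
  have hsub : Ioo a b ⊆ Ioc a (a + 2 * π) := fun x hx ↦ ⟨hx.1, hx.2.le.trans hab⟩
  rw [← lintegral_indicator hJ, lintegral_circleArcLength (hg.indicator hJ) a,
    show ∫⁻ θ in Ioo a b, g (Circle.exp θ) =
      ∫⁻ θ in Ioo a b ∩ Ioc a (a + 2 * π), g (Circle.exp θ) by
        rw [inter_eq_self_of_subset_left hsub], ← setLIntegral_indicator measurableSet_Ioo]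
  refine setLIntegral_congr_fun measurableSet_Ioc fun θ hθ ↦ ?_
  by_cases h : θ ∈ Ioo a b
  · rw [indicator_of_mem h, indicator_of_mem (mem_image_of_mem _ h)]
  · rw [indicator_of_notMem h, indicator_of_notMem]
    rintro ⟨t, ht, hte⟩
    rw [Circle.exp_injOn_Ioc (by linarith : a + 2 * π - a ≤ 2 * π) (hsub ht) hθ hte] at ht
    exact h ht

theorem circleArcLength_exp_image_Ioo {a b : ℝ} (hab : b ≤ a + 2 * π) :
    circleArcLength (Circle.exp '' Ioo a b) = ENNReal.ofReal (b - a) := by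
  rw [← setLIntegral_one, setLIntegral_exp_image_Ioo hab measurable_const, setLIntegral_one,
    Real.volume_Ioo]

theorem setLIntegral_Ioo_sub_rpow {a b p : ℝ} (hab : a ≤ b) (hp : p < 1) :
    ∫⁻ θ in Ioo a b, ENNReal.ofReal ((θ - a) ^ (-p)) =
      ENNReal.ofReal ((b - a) ^ (1 - p) / (1 - p)) := by
  have hi : IntervalIntegrable (fun x : ℝ ↦ x ^ (-p)) volume 0 (b - a) :=
    intervalIntegral.intervalIntegrable_rpow' (by linarith)
  have hi' : IntervalIntegrable (fun x : ℝ ↦ (x - a) ^ (-p)) volume a b := by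
    simpa using hi.comp_sub_right a
  rw [← ofReal_integral_eq_lintegral_ofReal]
  · rw [← integral_Ioc_eq_integral_Ioo, ← intervalIntegral.integral_of_le hab,
      intervalIntegral.integral_comp_sub_right (fun x ↦ x ^ (-p)) a, sub_self,
      integral_rpow (Or.inl (by linarith)), Real.zero_rpow (by linarith)]
    congr 2
    · rw [sub_zero]
      congr 1
      ring
    · ring
  · exact ((intervalIntegrable_iff_integrableOn_Ioc_of_le hab).1 hi').mono_set Ioo_subset_Ioc_self
  · filter_upwards [ae_restrict_mem measurableSet_Ioo] with x hx
    exact Real.rpow_nonneg (by linarith [hx.1]) _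

theorem setLIntegral_Ioo_rpow_sub {a b p : ℝ} (hab : a ≤ b) (hp : p < 1) :
    ∫⁻ θ in Ioo a b, ENNReal.ofReal ((b - θ) ^ (-p)) =
      ENNReal.ofReal ((b - a) ^ (1 - p) / (1 - p)) := by
  have h := setLIntegral_Ioo_sub_rpow hab hp
  rw [← h, ← lintegral_indicator measurableSet_Ioo, ← lintegral_indicator measurableSet_Ioo,
    ← lintegral_sub_left_eq_self _ (a + b)]
  congr 1
  ext x
  have : a + b - x ∈ Ioo a b ↔ x ∈ Ioo a b := by
    constructor <;> rintro ⟨h1, h2⟩ <;> constructor <;> linarith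
  by_cases hx : x ∈ Ioo a b
  · rw [indicator_of_mem hx, indicator_of_mem (this.2 hx)]
    congr 2
    ring
  · rw [indicator_of_notMem hx, indicator_of_notMem (fun h' ↦ hx (this.1 h'))]

theorem Circle.edist_eq_ofReal (ζ ξ : Circle) : edist ζ ξ = ENNReal.ofReal ‖(ζ : ℂ) - ξ‖ := by
  rw [edist_dist, Circle.dist_eq_norm]

/-- Inside the arc, the chordal distance to `E` is at least 2/π times the angle to the nearer
endpoint, so the integral is dominated by two integrals of x^(-p). -/
theorem setLIntegral_infEDist_rpow_le {a b p : ℝ} (hab : a < b) (hab' : b ≤ a + 2 * π)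
    (hp0 : 0 < p) (hp : p < 1) {E : Set Circle} (hE : ∀ θ ∈ Ioo a b, Circle.exp θ ∉ E) :
    ∫⁻ ζ in Circle.exp '' Ioo a b, infEDist ζ E ^ (-p) ∂circleArcLength ≤
      ENNReal.ofReal ((2 / π) ^ (-p) * (2 / (1 - p))) *
        circleArcLength (Circle.exp '' Ioo a b) ^ (1 - p) := by
  rw [setLIntegral_exp_image_Ioo hab' (by fun_prop), circleArcLength_exp_image_Ioo hab']
  have hπ : 0 < 2 / π := by positivity
  have hd (θ : ℝ) (hθ : θ ∈ Ioo a b) :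
      ENNReal.ofReal (2 / π * min (θ - a) (b - θ)) ≤ infEDist (Circle.exp θ) E := by
    rw [le_infEDist]
    intro y hy
    obtain ⟨φ, hφ, rfl⟩ : ∃ φ ∈ Ico (θ - π) (θ - π + 2 * π), Circle.exp φ = y := by
      obtain ⟨ψ, rfl⟩ := Circle.exp_surjective y
      obtain ⟨φ, h1, h2⟩ := Circle.periodic_exp.exists_mem_Ico (by positivity) ψ (θ - π)
      exact ⟨φ, h1, h2.symm⟩
    rw [Circle.edist_eq_ofReal]
    apply ENNReal.ofReal_le_ofReal
    refine le_trans ?_ (le_norm_exp_sub_exp (abs_le.2 ⟨by linarith [hφ.2], by linarith [hφ.1]⟩))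
    gcongr
    have h : φ ≤ a ∨ b ≤ φ := by
      by_contra! h
      exact hE φ h hy
    rcases h with h | h
    · exact (min_le_left _ _).trans (le_abs.2 (Or.inl (by linarith)))
    · exact (min_le_right _ _).trans (le_abs.2 (Or.inr (by linarith)))
  calc ∫⁻ θ in Ioo a b, infEDist (Circle.exp θ) E ^ (-p)
      ≤ ∫⁻ θ in Ioo a b, ENNReal.ofReal ((2 / π) ^ (-p)) *
          (ENNReal.ofReal ((θ - a) ^ (-p)) + ENNReal.ofReal ((b - θ) ^ (-p))) := by
        refine setLIntegral_mono' measurableSet_Ioo fun θ hθ ↦ ?_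
        have h1 : 0 < θ - a := by linarith [hθ.1]
        have h2 : 0 < b - θ := by linarith [hθ.2]
        have hm : 0 < min (θ - a) (b - θ) := lt_min h1 h2
        calc infEDist (Circle.exp θ) E ^ (-p)
            ≤ ENNReal.ofReal (2 / π * min (θ - a) (b - θ)) ^ (-p) :=
              ENNReal.rpow_neg_le_rpow_neg hp0.le (hd θ hθ)
          _ = ENNReal.ofReal ((2 / π) ^ (-p)) *
                ENNReal.ofReal (min (θ - a) (b - θ) ^ (-p)) := by
              rw [ENNReal.ofReal_rpow_of_pos (by positivity), Real.mul_rpow hπ.le hm.le,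
                ENNReal.ofReal_mul (by positivity)]
          _ ≤ _ := by
              gcongr
              rcases min_choice (θ - a) (b - θ) with h | h <;> rw [h]
              · exact le_self_add
              · exact le_add_self
    _ = _ := by
        rw [lintegral_const_mul' _ _ ENNReal.ofReal_ne_top, lintegral_add_left (by fun_prop),
          setLIntegral_Ioo_sub_rpow hab.le hp, setLIntegral_Ioo_rpow_sub hab.le hp,
          ENNReal.ofReal_rpow_of_pos (by linarith), ← ENNReal.ofReal_add, ← ENNReal.ofReal_mul,
          ← ENNReal.ofReal_mul]
        · congr 1
          ring
        · have : 0 < 1 - p := by linarith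
          positivity
        · positivity
        all_goals
          have : 0 < b - a := by linarith
          have : 0 < 1 - p := by linarith
          positivity

/-- The endpoint a lies in `E`, so on the arc the distance to `E` never exceeds the length of the
arc. With the preceding bound, the Beurling–Carleson sum is comparable to the integral of dist^(-p).
-/
theorem rpow_circleArcLength_le {a b p : ℝ} (hab : a < b) (hab' : b ≤ a + 2 * π)
    (hp0 : 0 < p) {E : Set Circle} (ha : Circle.exp a ∈ E) :
    circleArcLength (Circle.exp '' Ioo a b) ^ (1 - p) ≤
      ∫⁻ ζ in Circle.exp '' Ioo a b, infEDist ζ E ^ (-p) ∂circleArcLength := by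
  rw [setLIntegral_exp_image_Ioo hab' (by fun_prop), circleArcLength_exp_image_Ioo hab']
  have hL : ENNReal.ofReal (b - a) ≠ 0 := by simpa using hab
  calc ENNReal.ofReal (b - a) ^ (1 - p)
      = ∫⁻ _ in Ioo a b, ENNReal.ofReal (b - a) ^ (-p) := by
        rw [setLIntegral_const, Real.volume_Ioo, show 1 - p = -p + 1 by ring,
          ENNReal.rpow_add _ _ hL ENNReal.ofReal_ne_top, ENNReal.rpow_one]
    _ ≤ _ := by
        refine setLIntegral_mono' measurableSet_Ioo fun θ hθ ↦ ?_
        refine ENNReal.rpow_neg_le_rpow_neg hp0.le ?_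
        refine (infEDist_le_edist_of_mem ha).trans ?_
        rw [Circle.edist_eq_ofReal]
        apply ENNReal.ofReal_le_ofReal
        refine (norm_exp_sub_exp_le _ _).trans ?_
        rw [abs_of_pos (by linarith [hθ.1])]
        linarith [hθ.2]

theorem isOpen_of_mem_complementaryArcs {E J : Set Circle} (hE : IsClosed E)
    (hJ : J ∈ complementaryArcs E) : IsOpen J := by
  rcases E.eq_empty_or_nonempty with rfl | hne
  · obtain ⟨x, -, rfl⟩ := hJ
    rw [compl_empty, connectedComponentIn_univ]
    have : LocallyConnectedSpace Circle :=
      isLocalHomeomorph_circleExp.isOpenMap.isQuotientMap Circle.exp.continuous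
        Circle.exp_surjective |>.locallyConnectedSpace
    exact isOpen_connectedComponent
  · obtain ⟨a, b, -, -, rfl, -⟩ := exists_eq_exp_image_Ioo hE hne hJ
    exact isLocalHomeomorph_circleExp.isOpenMap _ isOpen_Ioo

theorem pairwiseDisjoint_complementaryArcs (E : Set Circle) :
    (complementaryArcs E).PairwiseDisjoint id := by
  rintro _ ⟨x, hx, rfl⟩ _ ⟨y, hy, rfl⟩ hne
  rw [Function.onFun, Set.disjoint_left]
  rintro z hz1 hz2
  exact hne ((connectedComponentIn_eq hz1).trans (connectedComponentIn_eq hz2).symm)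

theorem nonempty_of_mem_complementaryArcs {E J : Set Circle} (hJ : J ∈ complementaryArcs E) :
    J.Nonempty := by
  obtain ⟨x, hx, rfl⟩ := hJ
  exact ⟨x, mem_connectedComponentIn hx⟩

theorem countable_complementaryArcs {E : Set Circle} (hE : IsClosed E) :
    (complementaryArcs E).Countable :=
  (pairwiseDisjoint_complementaryArcs E).countable_of_isOpen
    (fun _ hJ ↦ isOpen_of_mem_complementaryArcs hE hJ)
    fun _ hJ ↦ nonempty_of_mem_complementaryArcs hJ

theorem iUnion_complementaryArcs (E : Set Circle) : ⋃ J : complementaryArcs E, J.1 = Eᶜ := by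
  ext x
  simp only [mem_iUnion]
  constructor
  · rintro ⟨⟨_, y, hy, rfl⟩, hx⟩
    exact connectedComponentIn_subset _ _ hx
  · intro hx
    exact ⟨⟨_, x, hx, rfl⟩, mem_connectedComponentIn hx⟩

theorem IsBeurlingCarleson.lintegral_infEDist_lt_top {p : ℝ} (hp0 : 0 < p) (hp : p < 1)
    {E : Set Circle} (hE : IsBeurlingCarleson (1 - p) E) (hne : E.Nonempty) :
    ∫⁻ ζ, infEDist ζ E ^ (-p) ∂circleArcLength < ∞ := by
  have := (countable_complementaryArcs hE.isClosed).to_subtype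
  have hc : circleArcLength.restrict Eᶜ = circleArcLength :=
    Measure.restrict_eq_self_of_ae_mem (measure_eq_zero_iff_ae_notMem.1 hE.length_eq_zero)
  rw [← hc, ← iUnion_complementaryArcs]
  calc _ ≤ ∑' J : complementaryArcs E, ∫⁻ ζ in J.1, infEDist ζ E ^ (-p) ∂circleArcLength :=
        lintegral_iUnion_le _ _
    _ ≤ ∑' J : complementaryArcs E, ENNReal.ofReal ((2 / π) ^ (-p) * (2 / (1 - p))) *
          circleArcLength J.1 ^ (1 - p) := by
        refine ENNReal.tsum_le_tsum fun J ↦ ?_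
        obtain ⟨a, b, hab, hab', hJ, -, -, hgap⟩ :=
          exists_eq_exp_image_Ioo hE.isClosed hne J.2
        rw [hJ]
        exact setLIntegral_infEDist_rpow_le hab hab' hp0 hp hgap
    _ < ∞ := by
        rw [ENNReal.tsum_mul_left]
        exact ENNReal.mul_lt_top ENNReal.ofReal_lt_top hE.sum_lt_top

theorem IsBeurlingCarleson.of_lintegral_infEDist_lt_top {p : ℝ} (hp0 : 0 < p)
    {E : Set Circle} (hE : IsClosed E) (hne : E.Nonempty)
    (h : ∫⁻ ζ, infEDist ζ E ^ (-p) ∂circleArcLength < ∞) : IsBeurlingCarleson (1 - p) E where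
  isClosed := hE
  length_eq_zero := by
    -- The integrand is `0 ^ (-p) = ∞` on `E`, so its integrability already forces `E` to be null.
    have h1 := ae_lt_top (by fun_prop) h.ne
    refine measure_mono_null (fun ζ hζ ↦ ?_) h1
    simp [infEDist_zero_of_mem hζ, hp0]
  sum_lt_top := by
    have := (countable_complementaryArcs hE).to_subtype
    refine lt_of_le_of_lt ?_ h
    calc _ ≤ ∑' J : complementaryArcs E, ∫⁻ ζ in J.1, infEDist ζ E ^ (-p) ∂circleArcLength := by
          refine ENNReal.tsum_le_tsum fun J ↦ ?_
          obtain ⟨a, b, hab, hab', hJ, ha, -⟩ := exists_eq_exp_image_Ioo hE hne J.2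
          rw [hJ]
          exact rpow_circleArcLength_le hab hab' hp0 ha
      _ = ∫⁻ ζ in ⋃ J : complementaryArcs E, J.1, infEDist ζ E ^ (-p) ∂circleArcLength := by
          rw [lintegral_iUnion (fun J ↦ (isOpen_of_mem_complementaryArcs hE J.2).measurableSet)]
          intro J K hJK
          exact pairwiseDisjoint_complementaryArcs E J.2 K.2 (fun h ↦ hJK (Subtype.ext h))
      _ ≤ _ := setLIntegral_le_lintegral _ _

/-! ### The potential, the modulus of the singular inner function and its derivative. -/

/-- The potential `∫ |ξ - z|⁻² dμ(ξ)`. -/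
noncomputable def inverseSquarePotential (μ : Measure Circle) (z : ℂ) : ℝ≥0∞ :=
  ∫⁻ ξ : Circle, (‖(ξ : ℂ) - z‖ₑ ^ 2)⁻¹ ∂μ

theorem one_sub_norm_le_norm_sub (ξ : Circle) (z : ℂ) : 1 - ‖z‖ ≤ ‖(ξ : ℂ) - z‖ := by
  simpa only [Circle.norm_coe] using norm_sub_norm_le (ξ : ℂ) z

theorem Circle.sub_ne_zero_of_norm_lt_one (ξ : Circle) {z : ℂ} (hz : ‖z‖ < 1) :
    (ξ : ℂ) - z ≠ 0 := by
  have := one_sub_norm_le_norm_sub ξ z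
  exact norm_pos_iff.1 (by linarith)

theorem re_herglotz (ξ : Circle) (z : ℂ) :
    (((ξ : ℂ) + z) / (ξ - z)).re = (1 - ‖z‖ ^ 2) * (‖(ξ : ℂ) - z‖ ^ 2)⁻¹ := by
  have h := congrFun (poissonKernel_eq_re_herglotzRieszKernel (c := 0) (w := z)) (ξ : ℂ)
  simp only [Function.comp_apply, poissonKernel_def, herglotzRieszKernel_def, sub_zero,
    Circle.norm_coe] at h
  rw [← h]
  simp [div_eq_mul_inv]

theorem inverseSquarePotential_eq_ofReal (μ : Measure Circle) [IsFiniteMeasure μ] {z : ℂ}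
    (hz : ‖z‖ < 1) :
    Integrable (fun ξ : Circle ↦ (‖(ξ : ℂ) - z‖ ^ 2)⁻¹) μ ∧
      inverseSquarePotential μ z = ENNReal.ofReal (∫ ξ : Circle, (‖(ξ : ℂ) - z‖ ^ 2)⁻¹ ∂μ) := by
  have hc : Continuous fun ξ : Circle ↦ (‖(ξ : ℂ) - z‖ ^ 2)⁻¹ := by
    refine Continuous.inv₀ (by fun_prop) fun ξ ↦ ?_
    simpa using ξ.sub_ne_zero_of_norm_lt_one hz
  have hi : Integrable (fun ξ : Circle ↦ (‖(ξ : ℂ) - z‖ ^ 2)⁻¹) μ :=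
    hc.integrable_of_hasCompactSupport (HasCompactSupport.of_compactSpace _)
  refine ⟨hi, ?_⟩
  rw [ofReal_integral_eq_lintegral_ofReal hi (ae_of_all _ fun ξ ↦ by positivity)]
  refine lintegral_congr fun ξ ↦ ?_
  have : 0 < ‖(ξ : ℂ) - z‖ := norm_pos_iff.2 (ξ.sub_ne_zero_of_norm_lt_one hz)
  rw [ENNReal.ofReal_inv_of_pos (by positivity), ENNReal.ofReal_pow (norm_nonneg _),
    ofReal_norm]

theorem inverseSquarePotential_lt_top (μ : Measure Circle) [IsFiniteMeasure μ] {z : ℂ}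
    (hz : ‖z‖ < 1) : inverseSquarePotential μ z < ∞ := by
  rw [(inverseSquarePotential_eq_ofReal μ hz).2]
  exact ENNReal.ofReal_lt_top

theorem integrable_herglotz (μ : Measure Circle) [IsFiniteMeasure μ] {z : ℂ} (hz : ‖z‖ < 1) :
    Integrable (fun ξ : Circle ↦ ((ξ : ℂ) + z) / (ξ - z)) μ := by
  have hc : Continuous fun ξ : Circle ↦ ((ξ : ℂ) + z) / (ξ - z) :=
    Continuous.div (by fun_prop) (by fun_prop) fun ξ ↦ ξ.sub_ne_zero_of_norm_lt_one hz
  exact hc.integrable_of_hasCompactSupport (HasCompactSupport.of_compactSpace _)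

theorem norm_singularInner (μ : Measure Circle) [IsFiniteMeasure μ] {z : ℂ} (hz : ‖z‖ < 1) :
    ‖singularInner μ z‖ =
      Real.exp (-((1 - ‖z‖ ^ 2) * (inverseSquarePotential μ z).toReal)) := by
  have h := inverseSquarePotential_eq_ofReal μ hz
  rw [singularInner, Complex.norm_exp, Complex.neg_re, h.2,
    ENNReal.toReal_ofReal (integral_nonneg fun ξ ↦ by positivity), ← integral_const_mul]
  congr 2
  rw [← RCLike.re_eq_complex_re, ← integral_re (integrable_herglotz μ hz)]
  exact integral_congr_ae (ae_of_all _ fun ξ ↦ re_herglotz ξ z)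

/-- The second alternative is needed since `ENNReal.ofReal` truncates -log c to 0 when c > 1. -/
theorem norm_singularInner_lt_iff (μ : Measure Circle) [IsFiniteMeasure μ] {z : ℂ}
    (hz : ‖z‖ < 1) {c : ℝ} (hc : 0 < c) :
    ‖singularInner μ z‖ < c ↔
      ENNReal.ofReal (-Real.log c) < ENNReal.ofReal (1 - ‖z‖ ^ 2) * inverseSquarePotential μ z ∨
        1 < c := by
  rw [norm_singularInner μ hz, ← Real.lt_log_iff_exp_lt hc,
    ← ENNReal.ofReal_toReal (inverseSquarePotential_lt_top μ hz).ne]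
  have h0 : 0 ≤ 1 - ‖z‖ ^ 2 := by nlinarith [norm_nonneg z]
  set V := (inverseSquarePotential μ z).toReal
  have hV : 0 ≤ V := ENNReal.toReal_nonneg
  rw [← ENNReal.ofReal_mul h0, ENNReal.ofReal_lt_ofReal_iff', ENNReal.toReal_ofReal hV,
    ← Real.log_pos_iff hc.le]
  constructor
  · intro h
    by_cases h1 : 0 < Real.log c
    · exact Or.inr h1
    · exact Or.inl ⟨by linarith, by linarith⟩
  · rintro (h | h)
    · linarith [h.1]
    · nlinarith [mul_nonneg h0 hV]

theorem hasDerivAt_integral_herglotz (μ : Measure Circle) [IsFiniteMeasure μ] {z : ℂ}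
    (hz : ‖z‖ < 1) :
    HasDerivAt (fun w ↦ ∫ ξ : Circle, ((ξ : ℂ) + w) / (ξ - w) ∂μ)
      (∫ ξ : Circle, 2 * (ξ : ℂ) / (ξ - z) ^ 2 ∂μ) z := by
  set ε := (1 - ‖z‖) / 2 with hε
  have hε0 : 0 < ε := by rw [hε]; linarith
  have hball (w : ℂ) (hw : w ∈ ball z ε) : ‖w‖ < 1 - ε := by
    rw [mem_ball, dist_eq_norm] at hw
    have := norm_sub_norm_le w z
    linarith
  refine (hasDerivAt_integral_of_dominated_loc_of_deriv_le (ball_mem_nhds z hε0) ?_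
    (F := fun w (ξ : Circle) ↦ ((ξ : ℂ) + w) / (ξ - w))
    (integrable_herglotz μ hz) (F' := fun w (ξ : Circle) ↦ 2 * (ξ : ℂ) / (ξ - w) ^ 2)
    (bound := fun _ ↦ 2 / ε ^ 2) ?_ ?_ (integrable_const _) ?_).2
  · filter_upwards [ball_mem_nhds z hε0] with w hw
    exact (integrable_herglotz μ (by linarith [hball w hw])).aestronglyMeasurable
  · refine Continuous.aestronglyMeasurable ?_
    exact Continuous.div (by fun_prop) (by fun_prop)
      fun ξ ↦ pow_ne_zero _ (ξ.sub_ne_zero_of_norm_lt_one hz)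
  · refine ae_of_all _ fun ξ w hw ↦ ?_
    have h1 := hball w hw
    have h2 := one_sub_norm_le_norm_sub ξ w
    simp only [norm_div, norm_mul, norm_pow, Circle.norm_coe, Complex.norm_ofNat, mul_one]
    gcongr
    linarith
  · refine ae_of_all _ fun ξ w hw ↦ ?_
    have h1 := hball w hw
    have h2 := ξ.sub_ne_zero_of_norm_lt_one (z := w) (by linarith)
    have h3 := ((hasDerivAt_id w).const_add (ξ : ℂ)).div ((hasDerivAt_id w).const_sub (ξ : ℂ)) h2
    rw [show (2 : ℂ) * ξ / (ξ - w) ^ 2 =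
      (1 * ((ξ : ℂ) - id w) - (ξ + id w) * -1) / (ξ - id w) ^ 2 by simp only [id]; ring]
    exact h3

theorem hasDerivAt_singularInner (μ : Measure Circle) [IsFiniteMeasure μ] {z : ℂ}
    (hz : ‖z‖ < 1) :
    HasDerivAt (singularInner μ)
      (-(singularInner μ z * ∫ ξ : Circle, 2 * (ξ : ℂ) / (ξ - z) ^ 2 ∂μ)) z := by
  have := (hasDerivAt_integral_herglotz μ hz).neg.cexp
  rw [mul_neg] at this
  exact this

theorem differentiableOn_singularInner (μ : Measure Circle) [IsFiniteMeasure μ] :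
    DifferentiableOn ℂ (singularInner μ) (ball 0 1) := fun z hz ↦
  (hasDerivAt_singularInner μ (by simpa using hz)).differentiableAt.differentiableWithinAt

theorem differentiableOn_deriv_singularInner (μ : Measure Circle) [IsFiniteMeasure μ] :
    DifferentiableOn ℂ (deriv (singularInner μ)) (ball 0 1) :=
  (differentiableOn_singularInner μ).deriv isOpen_ball

theorem norm_singularInner_le_one (μ : Measure Circle) [IsFiniteMeasure μ] {z : ℂ}
    (hz : ‖z‖ < 1) : ‖singularInner μ z‖ ≤ 1 := by
  rw [norm_singularInner μ hz, Real.exp_le_one_iff, neg_nonpos]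
  have h0 : 0 ≤ 1 - ‖z‖ ^ 2 := by nlinarith [norm_nonneg z]
  positivity

theorem enorm_deriv_singularInner_le (μ : Measure Circle) [IsFiniteMeasure μ] {z : ℂ}
    (hz : ‖z‖ < 1) :
    ‖deriv (singularInner μ) z‖ₑ ≤ 2 * inverseSquarePotential μ z := by
  rw [(hasDerivAt_singularInner μ hz).deriv, enorm_neg, enorm_mul, inverseSquarePotential]
  have h1 : ‖singularInner μ z‖ₑ ≤ 1 := by
    rw [← ofReal_norm, ← ENNReal.ofReal_one]
    exact ENNReal.ofReal_le_ofReal (norm_singularInner_le_one μ hz)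
  calc _ ≤ 1 * ∫⁻ ξ : Circle, ‖2 * (ξ : ℂ) / (ξ - z) ^ 2‖ₑ ∂μ := by
        gcongr
        exact enorm_integral_le_lintegral_enorm _
    _ = _ := by
        rw [one_mul, ← lintegral_const_mul' _ _ (by simp)]
        refine lintegral_congr fun ξ ↦ ?_
        have h2 := ξ.sub_ne_zero_of_norm_lt_one hz
        rw [div_eq_mul_inv, enorm_mul, enorm_mul, enorm_inv (pow_ne_zero _ h2), enorm_pow]
        have h3 : ‖(ξ : ℂ)‖ₑ = 1 := by rw [← ofReal_norm, Circle.norm_coe, ENNReal.ofReal_one]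
        have h4 : ‖(2 : ℂ)‖ₑ = 2 := by rw [← ofReal_norm]; simp
        rw [h3, h4, mul_one]

theorem norm_smul_circle {r : ℝ} (hr : 0 ≤ r) (ζ : Circle) : ‖(r : ℂ) * ζ‖ = r := by
  rw [norm_mul, Circle.norm_coe, Complex.norm_real, Real.norm_of_nonneg hr, mul_one]

theorem norm_sub_le_two_mul_norm_sub_smul (ξ ζ : Circle) {r : ℝ} (hr0 : 0 ≤ r) (hr : r ≤ 1) :
    ‖(ξ : ℂ) - ζ‖ ≤ 2 * ‖(ξ : ℂ) - r * ζ‖ := by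
  have h1 := one_sub_norm_le_norm_sub ξ (r * ζ)
  rw [norm_smul_circle hr0] at h1
  have h2 : ‖(r : ℂ) * ζ - ζ‖ = 1 - r := by
    rw [show (r : ℂ) * ζ - ζ = ((r - 1 : ℝ) : ℂ) * ζ by push_cast; ring]
    simp only [norm_mul, Complex.norm_real, Real.norm_eq_abs, Circle.norm_coe, mul_one]
    rw [abs_of_nonpos (by linarith)]
    ring
  have h3 := norm_sub_le_norm_sub_add_norm_sub (ξ : ℂ) (r * ζ) ζ
  linarith

/-- The constant is the square of the 2 in |ξ - ζ| ≤ 2|ξ - rζ|. This is what bounds quantities on a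
whole radius by the value of the potential at its endpoint. -/
theorem inverseSquarePotential_smul_le (μ : Measure Circle) (ζ : Circle) {r : ℝ}
    (hr0 : 0 ≤ r) (hr : r ≤ 1) :
    inverseSquarePotential μ (r * ζ) ≤ 4 * inverseSquarePotential μ ζ := by
  rw [inverseSquarePotential, inverseSquarePotential, ← lintegral_const_mul' _ _ (by simp)]
  refine lintegral_mono fun ξ ↦ ?_
  have h : ‖(ξ : ℂ) - ζ‖ₑ ≤ 2 * ‖(ξ : ℂ) - r * ζ‖ₑ := by
    simp_rw [← ofReal_norm]
    rw [show (2 : ℝ≥0∞) = ENNReal.ofReal 2 by simp, ← ENNReal.ofReal_mul (by norm_num)]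
    exact ENNReal.ofReal_le_ofReal (norm_sub_le_two_mul_norm_sub_smul ξ ζ hr0 hr)
  calc (‖(ξ : ℂ) - r * ζ‖ₑ ^ 2)⁻¹ = 4 * ((2 * ‖(ξ : ℂ) - r * ζ‖ₑ) ^ 2)⁻¹ := by
        rw [mul_pow, ENNReal.mul_inv (by simp) (by simp), ← mul_assoc,
          show (2 : ℝ≥0∞) ^ 2 = 4 by norm_num, ENNReal.mul_inv_cancel (by simp) (by simp), one_mul]
    _ ≤ 4 * (‖(ξ : ℂ) - ζ‖ₑ ^ 2)⁻¹ := by gcongr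

theorem inverseSquarePotential_mono {μ ν : Measure Circle} (h : μ ≤ ν) (z : ℂ) :
    inverseSquarePotential μ z ≤ inverseSquarePotential ν z :=
  lintegral_mono' h le_rfl

theorem measurable_inverseSquarePotential (μ : Measure Circle) [SFinite μ] :
    Measurable (inverseSquarePotential μ) := by
  have hm : Measurable fun q : ℂ × Circle ↦ (‖(q.2 : ℂ) - q.1‖ₑ ^ 2)⁻¹ := by fun_prop
  exact hm.lintegral_prod_right'

/-! ### The area condition along radii, and what integrability of V^p implies. -/

/-- The contribution of the radius ending at `ζ` to the integral in the area condition. -/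
noncomputable def radialArea (s : ℝ) (μ : Measure Circle) (c : ℝ) (ζ : Circle) : ℝ≥0∞ :=
  ∫⁻ r in {r : ℝ | r ∈ Ioo 0 1 ∧ ‖singularInner μ (r * ζ)‖ < c},
    ENNReal.ofReal r * ENNReal.ofReal (1 / (1 - r) ^ s)

theorem isOpen_sublevel_singularInner (μ : Measure Circle) [IsFiniteMeasure μ] (c : ℝ) :
    IsOpen {z : ℂ | ‖z‖ < 1 ∧ ‖singularInner μ z‖ < c} := by
  have h := (differentiableOn_singularInner μ).continuousOn.norm.isOpen_inter_preimage isOpen_ball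
    (isOpen_Iio (a := c))
  convert h using 1
  ext z
  simp

theorem measurableSet_radial_sublevel (μ : Measure Circle) [IsFiniteMeasure μ] (c : ℝ)
    (ζ : Circle) : MeasurableSet {r : ℝ | r ∈ Ioo 0 1 ∧ ‖singularInner μ (r * ζ)‖ < c} := by
  have h : IsOpen (Ioi (0 : ℝ) ∩
      (fun r : ℝ ↦ (r : ℂ) * ζ) ⁻¹' {z : ℂ | ‖z‖ < 1 ∧ ‖singularInner μ z‖ < c}) :=
    isOpen_Ioi.inter ((isOpen_sublevel_singularInner μ c).preimage (by fun_prop))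
  convert h.measurableSet using 1
  ext r
  simp only [mem_ofPred_eq, mem_Ioo, mem_inter_iff, mem_Ioi, mem_preimage, and_assoc]
  refine and_congr_right fun hr ↦ ?_
  rw [norm_smul_circle hr.le]

theorem setLIntegral_sublevel_eq (s : ℝ) (μ : Measure Circle) [IsFiniteMeasure μ] (c : ℝ) :
    ∫⁻ z in {z : ℂ | ‖z‖ < 1 ∧ ‖singularInner μ z‖ < c}, ENNReal.ofReal (1 / (1 - ‖z‖) ^ s) =
      ∫⁻ ζ, radialArea s μ c ζ ∂circleArcLength := by
  have hA := (isOpen_sublevel_singularInner μ c).measurableSet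
  rw [← lintegral_indicator hA, lintegral_polar (Measurable.indicator (by fun_prop) hA)]
  refine lintegral_congr fun ζ ↦ ?_
  rw [radialArea, ← lintegral_indicator measurableSet_Ioi,
    ← lintegral_indicator (measurableSet_radial_sublevel μ c ζ)]
  refine lintegral_congr fun r ↦ ?_
  by_cases hr : 0 < r
  · rw [indicator_of_mem (mem_Ioi.2 hr)]
    by_cases h : r < 1 ∧ ‖singularInner μ (r * ζ)‖ < c
    · rw [indicator_of_mem, indicator_of_mem, norm_smul_circle hr.le]
      · exact ⟨⟨hr, h.1⟩, h.2⟩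
      · exact ⟨by rw [norm_smul_circle hr.le]; exact h.1, h.2⟩
    · rw [indicator_of_notMem, indicator_of_notMem, mul_zero]
      · exact fun h' ↦ h ⟨h'.1.2, h'.2⟩
      · exact fun h' ↦ h ⟨by simpa only [norm_smul_circle hr.le] using h'.1, h'.2⟩
  · rw [indicator_of_notMem (by simpa using hr), indicator_of_notMem fun h ↦ hr h.1.1]

theorem areaCondition_iff (s : ℝ) (μ : Measure Circle) [IsFiniteMeasure μ] :
    AreaCondition s μ ↔ ∀ c : ℝ, 0 < c → c < 1 →
      ∫⁻ ζ, radialArea s μ c ζ ∂circleArcLength < ∞ := by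
  simp_rw [AreaCondition, setLIntegral_sublevel_eq]

/-- One segment of length a at height about a already contributes a multiple of a^(-p). The
condition on 2a keeps r ≥ 1/2, so the polar factor r costs only a factor 2. -/
theorem ofReal_rpow_neg_le_radialArea {p : ℝ} (hp0 : 0 < p) (hp : p < 1) {μ : Measure Circle}
    {c : ℝ} {ζ : Circle} {a : ℝ} (ha : 0 < a) (ha' : 2 * a ≤ 1 / 2)
    (h : ∀ r ∈ Ioo (1 - 2 * a) (1 - a), ‖singularInner μ (r * ζ)‖ < c) :
    ENNReal.ofReal (a ^ (-p)) ≤ 8 * radialArea (1 + p) μ c ζ := by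
  have hsub : Ioo (1 - 2 * a) (1 - a) ⊆
      {r : ℝ | r ∈ Ioo 0 1 ∧ ‖singularInner μ (r * ζ)‖ < c} := fun r hr ↦
    ⟨⟨by linarith [hr.1], by linarith [hr.2]⟩, h r hr⟩
  have h1 : ENNReal.ofReal (1 / 2 * (1 / (2 * a) ^ (1 + p)) * a) ≤ radialArea (1 + p) μ c ζ := by
    refine le_trans ?_ (lintegral_mono_set hsub)
    calc _ = ∫⁻ _ in Ioo (1 - 2 * a) (1 - a), ENNReal.ofReal (1 / 2 * (1 / (2 * a) ^ (1 + p))) := by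
          rw [setLIntegral_const, Real.volume_Ioo, ← ENNReal.ofReal_mul (by positivity)]
          congr 2
          ring
      _ ≤ _ := by
          refine setLIntegral_mono' measurableSet_Ioo fun r hr ↦ ?_
          rw [← ENNReal.ofReal_mul (by linarith [hr.1])]
          apply ENNReal.ofReal_le_ofReal
          have h2 : 0 < 1 - r := by linarith [hr.2]
          gcongr
          all_goals linarith [hr.1]
  calc ENNReal.ofReal (a ^ (-p))
      ≤ ENNReal.ofReal (8 * (1 / 2 * (1 / (2 * a) ^ (1 + p)) * a)) := by
        apply ENNReal.ofReal_le_ofReal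
        -- The left factor simplifies to 2 / 2^p, which is at least 1 because p < 1; this is where 8
        -- comes from.
        rw [Real.mul_rpow (by norm_num) ha.le, Real.rpow_add (by norm_num : (0 : ℝ) < 2),
          Real.rpow_add ha, Real.rpow_neg ha.le, Real.rpow_one, Real.rpow_one]
        have h2 : (2 : ℝ) ^ p ≤ 2 ^ (1 : ℝ) := Real.rpow_le_rpow_of_exponent_le (by norm_num) hp.le
        rw [Real.rpow_one] at h2
        have h3 : 0 < a ^ p := by positivity
        have h4 : 8 * (1 / 2 * (1 / (2 * (2 : ℝ) ^ p * (a * a ^ p))) * a) =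
            (2 / 2 ^ p) * (a ^ p)⁻¹ := by
          field_simp
          norm_num
        rw [h4]
        refine le_mul_of_one_le_left (by positivity) ?_
        rwa [one_le_div (by positivity)]
    _ = 8 * ENNReal.ofReal (1 / 2 * (1 / (2 * a) ^ (1 + p)) * a) := by
        rw [ENNReal.ofReal_mul (by norm_num)]
        simp
    _ ≤ _ := by gcongr

theorem radialArea_le_ofReal {p : ℝ} (hp0 : 0 < p) {μ : Measure Circle}
    {c : ℝ} {ζ : Circle} {a : ℝ} (ha : 0 < a)
    (h : ∀ r ∈ Ioo (0 : ℝ) 1, ‖singularInner μ (r * ζ)‖ < c → r ≤ 1 - a) :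
    radialArea (1 + p) μ c ζ ≤ ENNReal.ofReal (a ^ (-p) / p) := by
  rcases lt_or_ge a 1 with ha1 | ha1
  · have hsub : {r : ℝ | r ∈ Ioo 0 1 ∧ ‖singularInner μ (r * ζ)‖ < c} ⊆ Ioc 0 (1 - a) :=
      fun r hr ↦ ⟨hr.1.1, h r hr.1 hr.2⟩
    have h0 : (0 : ℝ) ∉ uIcc a 1 := by
      rw [uIcc_of_le ha1.le]
      exact fun h' ↦ absurd h'.1 (not_le.2 ha)
    have hi : IntervalIntegrable (fun r : ℝ ↦ (1 - r) ^ (-(1 + p))) volume 0 (1 - a) := by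
      have := (intervalIntegral.intervalIntegrable_rpow (μ := volume) (r := -(1 + p))
        (Or.inr h0)).comp_sub_left 1
      simpa using this.symm
    calc radialArea (1 + p) μ c ζ
        ≤ ∫⁻ r in Ioc 0 (1 - a), ENNReal.ofReal r * ENNReal.ofReal (1 / (1 - r) ^ (1 + p)) :=
          lintegral_mono_set hsub
      _ ≤ ∫⁻ r in Ioc 0 (1 - a), ENNReal.ofReal ((1 - r) ^ (-(1 + p))) := by
          refine setLIntegral_mono' measurableSet_Ioc fun r hr ↦ ?_
          have h1 : 0 < 1 - r := by linarith [hr.2]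
          rw [Real.rpow_neg h1.le, one_div]
          refine mul_le_of_le_one_left zero_le ?_
          rw [← ENNReal.ofReal_one]
          exact ENNReal.ofReal_le_ofReal (by linarith [hr.2])
      _ = ENNReal.ofReal ((a ^ (-p) - 1) / p) := by
          rw [← ofReal_integral_eq_lintegral_ofReal]
          · rw [← intervalIntegral.integral_of_le (by linarith),
              intervalIntegral.integral_comp_sub_left (fun x ↦ x ^ (-(1 + p))) 1,
              sub_sub_cancel, sub_zero, integral_rpow (Or.inr ⟨by linarith, h0⟩), Real.one_rpow]
            congr 1
            rw [show -(1 + p) + 1 = -p by ring, div_neg, ← neg_div, neg_sub]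
          · exact (intervalIntegrable_iff_integrableOn_Ioc_of_le (by linarith)).1 hi
          · filter_upwards [ae_restrict_mem measurableSet_Ioc] with x hx
            exact Real.rpow_nonneg (by linarith [hx.2]) _
      _ ≤ _ := by
          apply ENNReal.ofReal_le_ofReal
          gcongr
          linarith
  · rw [radialArea, show {r : ℝ | r ∈ Ioo 0 1 ∧ ‖singularInner μ (r * ζ)‖ < c} = ∅ by
      rw [eq_empty_iff_forall_notMem]
      rintro r ⟨hr, hr'⟩
      linarith [h r hr hr', hr.1]]
    simp

theorem radialArea_le_rpow {p : ℝ} (hp0 : 0 < p) (μ : Measure Circle) [IsFiniteMeasure μ]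
    {c : ℝ} (hc0 : 0 < c) (hc : c < 1) {ζ : Circle} (hV : inverseSquarePotential μ ζ ≠ ∞) :
    radialArea (1 + p) μ c ζ ≤
      ENNReal.ofReal ((8 / -Real.log c) ^ p / p) * inverseSquarePotential μ ζ ^ p := by
  set v := (inverseSquarePotential μ ζ).toReal with hv
  have hVv : inverseSquarePotential μ ζ = ENNReal.ofReal v := (ENNReal.ofReal_toReal hV).symm
  have hv0 : 0 ≤ v := ENNReal.toReal_nonneg
  set t := -Real.log c with ht
  have ht0 : 0 < t := by
    rw [ht, neg_pos]
    exact Real.log_neg hc0 hc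
  -- Combine V(rζ) ≤ 4V(ζ) with 1 - r² ≤ 2(1 - r): the sublevel set stays at height at least t /
  -- (8v).
  have key : ∀ r ∈ Ioo (0 : ℝ) 1, ‖singularInner μ (r * ζ)‖ < c → t < 8 * v * (1 - r) := by
    intro r hr h
    have hn := norm_smul_circle hr.1.le ζ
    have h1 : ‖(r : ℂ) * ζ‖ < 1 := by rw [hn]; exact hr.2
    rw [norm_singularInner_lt_iff μ h1 hc0, or_iff_left (by linarith), hn] at h
    have h2 : ENNReal.ofReal t < ENNReal.ofReal ((1 - r ^ 2) * (4 * v)) := by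
      refine h.trans_le ?_
      rw [ENNReal.ofReal_mul (by nlinarith [hr.1, hr.2]), ENNReal.ofReal_mul (by norm_num), ← hVv]
      gcongr
      simpa using inverseSquarePotential_smul_le μ ζ hr.1.le hr.2.le
    have h3 := (ENNReal.ofReal_lt_ofReal_iff'.1 h2).1
    nlinarith [mul_nonneg hv0 (sq_nonneg (1 - r))]
  rcases hv0.eq_or_lt with hv0 | hv0
  · rw [radialArea, show {r : ℝ | r ∈ Ioo 0 1 ∧ ‖singularInner μ (r * ζ)‖ < c} = ∅ by
      rw [eq_empty_iff_forall_notMem]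
      rintro r ⟨hr, hr'⟩
      have := key r hr hr'
      rw [← hv0] at this
      linarith]
    simp
  · refine (radialArea_le_ofReal hp0 (a := t / (8 * v)) (by positivity) fun r hr h ↦ ?_).trans ?_
    · have h1 := key r hr h
      have : t / (8 * v) ≤ 1 - r := by
        rw [div_le_iff₀ (by positivity)]
        linarith
      linarith
    · rw [hVv, ENNReal.ofReal_rpow_of_pos hv0, ← ENNReal.ofReal_mul (by positivity)]
      apply ENNReal.ofReal_le_ofReal
      apply le_of_eq
      rw [Real.rpow_neg (by positivity), ← Real.inv_rpow (by positivity), inv_div,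
        mul_div_right_comm, Real.mul_rpow (by positivity) hv0.le]
      ring

theorem areaCondition_of_lintegral_potential_lt_top {p : ℝ} (hp0 : 0 < p) (μ : Measure Circle)
    [IsFiniteMeasure μ]
    (h : ∫⁻ ζ : Circle, inverseSquarePotential μ ζ ^ p ∂circleArcLength < ∞) :
    AreaCondition (1 + p) μ := by
  rw [areaCondition_iff]
  intro c hc0 hc
  have hm : Measurable fun ζ : Circle ↦ inverseSquarePotential μ ζ :=
    (measurable_inverseSquarePotential μ).comp (by fun_prop : Continuous fun ζ : Circle ↦ (ζ : ℂ)).measurable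
  have h1 := ae_lt_top (hm.pow_const p) h.ne
  calc _ ≤ ∫⁻ ζ : Circle, ENNReal.ofReal ((8 / -Real.log c) ^ p / p) *
        inverseSquarePotential μ ζ ^ p ∂circleArcLength := by
        refine lintegral_mono_ae ?_
        filter_upwards [h1] with ζ hζ
        refine radialArea_le_rpow hp0 μ hc0 hc fun h' ↦ ?_
        rw [h', ENNReal.top_rpow_of_pos hp0] at hζ
        exact lt_irrefl _ hζ
    _ < ∞ := by
        rw [lintegral_const_mul' _ _ ENNReal.ofReal_ne_top]
        exact ENNReal.mul_lt_top ENNReal.ofReal_lt_top h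

theorem memHardy_deriv_of_lintegral_potential_lt_top {p : ℝ} (hp0 : 0 < p) (μ : Measure Circle)
    [IsFiniteMeasure μ]
    (h : ∫⁻ ζ : Circle, inverseSquarePotential μ ζ ^ p ∂circleArcLength < ∞) :
    MemHardy p (deriv (singularInner μ)) := by
  refine ⟨differentiableOn_deriv_singularInner μ, lt_of_le_of_lt (iSup_le fun r ↦ ?_)
    (ENNReal.mul_lt_top (a := 8 ^ p) (ENNReal.rpow_lt_top_of_nonneg hp0.le (by simp)) h)⟩
  rw [← lintegral_const_mul' _ _ (ENNReal.rpow_lt_top_of_nonneg hp0.le (by simp)).ne]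
  refine lintegral_mono fun ζ ↦ ?_
  rw [← ENNReal.mul_rpow_of_nonneg _ _ hp0.le]
  gcongr
  calc _ ≤ 2 * inverseSquarePotential μ ((r : ℝ) * ζ) :=
        enorm_deriv_singularInner_le μ (by rw [norm_smul_circle r.2.1]; exact r.2.2)
    _ ≤ 2 * (4 * inverseSquarePotential μ ζ) := by
        gcongr
        exact inverseSquarePotential_smul_le μ ζ r.2.1 r.2.2.le
    _ = _ := by rw [← mul_assoc]; norm_num

/-! ### From the area condition on a Beurling–Carleson set to integrability of V^p. -/

/-- For ξ in the carrier `E`, |ξ - rζ| ≤ |ξ - ζ| + (1 - r) ≤ 2|ξ - ζ|. This reverses the radial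
bound as long as the height is at most the distance to `E`. -/
theorem inverseSquarePotential_le_four_mul {μ : Measure Circle} {E : Set Circle} (hμ : μ Eᶜ = 0)
    {ζ : Circle} {r : ℝ} (hr : r ≤ 1) (h : ENNReal.ofReal (1 - r) ≤ infEDist ζ E) :
    inverseSquarePotential μ ζ ≤ 4 * inverseSquarePotential μ (r * ζ) := by
  rw [inverseSquarePotential, inverseSquarePotential, ← lintegral_const_mul' _ _ (by simp)]
  refine lintegral_mono_ae ?_
  filter_upwards [measure_eq_zero_iff_ae_notMem.1 hμ] with ξ hξ
  have hd : ENNReal.ofReal (1 - r) ≤ ‖(ξ : ℂ) - ζ‖ₑ := by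
    rw [← ofReal_norm, ← Circle.edist_eq_ofReal, edist_comm]
    exact h.trans (infEDist_le_edist_of_mem (by simpa using hξ))
  have h1 : ‖(ξ : ℂ) - r * ζ‖ₑ ≤ 2 * ‖(ξ : ℂ) - ζ‖ₑ := by
    have e : (ξ : ℂ) - r * ζ = ((ξ : ℂ) - ζ) + ((1 - r : ℝ) : ℂ) * ζ := by push_cast; ring
    rw [e, two_mul]
    refine (enorm_add_le _ _).trans (add_le_add le_rfl ?_)
    rwa [← ofReal_norm, norm_smul_circle (by linarith)]
  calc (‖(ξ : ℂ) - ζ‖ₑ ^ 2)⁻¹ = 4 * ((2 * ‖(ξ : ℂ) - ζ‖ₑ) ^ 2)⁻¹ := by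
        rw [mul_pow, ENNReal.mul_inv (by simp) (by simp), ← mul_assoc,
          show (2 : ℝ≥0∞) ^ 2 = 4 by norm_num, ENNReal.mul_inv_cancel (by simp) (by simp), one_mul]
    _ ≤ _ := by gcongr

theorem Circle.infEDist_le_two (ζ : Circle) {E : Set Circle} (hne : E.Nonempty) :
    infEDist ζ E ≤ ENNReal.ofReal 2 := by
  obtain ⟨ξ, hξ⟩ := hne
  refine (infEDist_le_edist_of_mem hξ).trans ?_
  rw [Circle.edist_eq_ofReal]
  apply ENNReal.ofReal_le_ofReal
  have := norm_sub_le (ζ : ℂ) ξ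
  rw [Circle.norm_coe, Circle.norm_coe] at this
  linarith

theorem inverseSquarePotential_lt_top_of_notMem {μ : Measure Circle} [IsFiniteMeasure μ]
    {E : Set Circle} (hE : IsClosed E) (hμ : μ Eᶜ = 0) {ζ : Circle} (hζ : ζ ∉ E) :
    inverseSquarePotential μ ζ < ∞ := by
  have hd : infEDist ζ E ≠ 0 := by
    rwa [Ne, ← mem_closure_iff_infEDist_zero, hE.closure_eq]
  calc inverseSquarePotential μ ζ ≤ ∫⁻ _, (infEDist ζ E ^ 2)⁻¹ ∂μ := by
        refine lintegral_mono_ae ?_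
        filter_upwards [measure_eq_zero_iff_ae_notMem.1 hμ] with ξ hξ
        gcongr
        rw [← ofReal_norm, ← Circle.edist_eq_ofReal, edist_comm]
        exact infEDist_le_edist_of_mem (by simpa using hξ)
    _ < ∞ := by
        rw [lintegral_const]
        exact ENNReal.mul_lt_top (by simp [hd, pos_iff_ne_zero]) (measure_lt_top _ _)

theorem rpow_inverseSquarePotential_le {p : ℝ} (hp0 : 0 < p) (hp : p < 1) (μ : Measure Circle)
    [IsFiniteMeasure μ] {E : Set Circle} (hE : IsClosed E) (hne : E.Nonempty) (hμ : μ Eᶜ = 0)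
    {ζ : Circle} (hζ : ζ ∉ E) :
    inverseSquarePotential μ ζ ^ p ≤
      32 * infEDist ζ E ^ (-p) + 32 * radialArea (1 + p) μ (Real.exp (-1)) ζ := by
  have hd2 := Circle.infEDist_le_two ζ hne
  have hdtop : infEDist ζ E ≠ ∞ := (hd2.trans_lt ENNReal.ofReal_lt_top).ne
  set d := (infEDist ζ E).toReal with hd
  have hdd : infEDist ζ E = ENNReal.ofReal d := (ENNReal.ofReal_toReal hdtop).symm
  have hd0 : 0 < d := by
    refine ENNReal.toReal_pos ?_ hdtop
    rwa [Ne, ← mem_closure_iff_infEDist_zero, hE.closure_eq]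
  have hd2 : d ≤ 2 := by
    rw [hdd] at hd2
    exact (ENNReal.ofReal_le_ofReal_iff (by norm_num)).1 hd2
  have hVtop := inverseSquarePotential_lt_top_of_notMem hE hμ hζ
  set v := (inverseSquarePotential μ ζ).toReal with hv
  have hVv : inverseSquarePotential μ ζ = ENNReal.ofReal v := (ENNReal.ofReal_toReal hVtop.ne).symm
  have hv0 : 0 ≤ v := ENNReal.toReal_nonneg
  -- In the second case take heights 1 - r between 4/v and 8/v. They are below d/4, hence below both
  -- d and 1/2, so V(rζ) ≥ v/4 and (1 - r²)V(rζ) > 1: `S_μ` is below e⁻¹ on a segment that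
  -- contributes a multiple of v^p.
  rcases le_or_gt v (32 / d) with hle | hgt
  · refine le_trans ?_ le_self_add
    rw [hVv, hdd, ENNReal.ofReal_rpow_of_nonneg hv0 hp0.le, ENNReal.ofReal_rpow_of_pos hd0,
      show (32 : ℝ≥0∞) = ENNReal.ofReal 32 by simp, ← ENNReal.ofReal_mul (by norm_num)]
    apply ENNReal.ofReal_le_ofReal
    calc v ^ p ≤ (32 / d) ^ p := by gcongr
      _ = 32 ^ p * d ^ (-p) := by
        rw [Real.div_rpow (by norm_num) hd0.le, Real.rpow_neg hd0.le, div_eq_mul_inv]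
      _ ≤ 32 ^ (1 : ℝ) * d ^ (-p) := by
        gcongr
        norm_num
      _ = _ := by rw [Real.rpow_one]
  · refine le_trans ?_ le_add_self
    have hv0 : 0 < v := lt_trans (by positivity) hgt
    have ha : 4 / v < d / 8 := by
      rw [div_lt_iff₀ hd0] at hgt
      rw [div_lt_div_iff₀ hv0 (by norm_num)]
      linarith
    have h1 := ofReal_rpow_neg_le_radialArea hp0 hp (μ := μ) (c := Real.exp (-1)) (ζ := ζ)
      (a := 4 / v) (by positivity) (by linarith) ?_
    · calc inverseSquarePotential μ ζ ^ p ≤ 4 * ENNReal.ofReal ((4 / v) ^ (-p)) := by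
            rw [hVv, ENNReal.ofReal_rpow_of_pos hv0,
              show (4 : ℝ≥0∞) = ENNReal.ofReal 4 by simp, ← ENNReal.ofReal_mul (by norm_num)]
            apply ENNReal.ofReal_le_ofReal
            rw [Real.rpow_neg (by positivity), Real.div_rpow (by norm_num) hv0.le, inv_div]
            have h4 : (4 : ℝ) ^ p ≤ 4 ^ (1 : ℝ) :=
              Real.rpow_le_rpow_of_exponent_le (by norm_num) hp.le
            rw [Real.rpow_one] at h4
            rw [mul_div_assoc', le_div_iff₀ (by positivity), mul_comm]
            gcongr
        _ ≤ 4 * (8 * radialArea (1 + p) μ (Real.exp (-1)) ζ) := by gcongr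
        _ = _ := by rw [← mul_assoc]; norm_num
    · intro r hr
      have hr0 : 0 ≤ r := by linarith [hr.1]
      have hr1 : r < 1 := by
        have : 0 < 4 / v := by positivity
        linarith [hr.2]
      have hn := norm_smul_circle hr0 ζ
      rw [norm_singularInner_lt_iff μ (by rw [hn]; exact hr1) (Real.exp_pos _), Real.log_exp,
        neg_neg, hn]
      left
      have h2 := inverseSquarePotential_le_four_mul hμ (ζ := ζ) hr1.le
        (by rw [hdd]; apply ENNReal.ofReal_le_ofReal; linarith [hr.1])
      set W := inverseSquarePotential μ (r * ζ) with hW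
      have hWtop : W < ∞ := inverseSquarePotential_lt_top μ (by rw [hn]; exact hr1)
      rw [← ENNReal.ofReal_toReal hWtop.ne] at h2 ⊢
      set w := W.toReal
      have h3 : v ≤ 4 * w := by
        rw [hVv, show (4 : ℝ≥0∞) = ENNReal.ofReal 4 by simp, ← ENNReal.ofReal_mul (by norm_num)] at h2
        exact (ENNReal.ofReal_le_ofReal_iff (by positivity)).1 h2
      rw [← ENNReal.ofReal_mul (by nlinarith), ENNReal.ofReal_lt_ofReal_iff']
      have h4 : 4 / v < 1 - r := by linarith [hr.2]
      rw [div_lt_iff₀ hv0] at h4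
      have h5 : 1 < (1 - r ^ 2) * w := by nlinarith [mul_nonneg hr0 (by linarith : 0 ≤ 1 - r)]
      exact ⟨h5, by linarith⟩

theorem lintegral_potential_lt_top_of_isBeurlingCarleson {p : ℝ} (hp0 : 0 < p) (hp : p < 1)
    (μ : Measure Circle) [IsFiniteMeasure μ] {E : Set Circle} (hE : IsBeurlingCarleson (1 - p) E)
    (hμ : μ Eᶜ = 0) (hA : AreaCondition (1 + p) μ) :
    ∫⁻ ζ : Circle, inverseSquarePotential μ ζ ^ p ∂circleArcLength < ∞ := by
  rcases E.eq_empty_or_nonempty with rfl | hne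
  · have : μ = 0 := by simpa using hμ
    simp [this, inverseSquarePotential, hp0]
  · rw [areaCondition_iff] at hA
    have h1 := hA (Real.exp (-1)) (Real.exp_pos _) (by simp)
    have h2 := hE.lintegral_infEDist_lt_top hp0 hp hne
    calc _ ≤ ∫⁻ ζ, (32 * infEDist ζ E ^ (-p) + 32 * radialArea (1 + p) μ (Real.exp (-1)) ζ)
          ∂circleArcLength := by
          refine lintegral_mono_ae ?_
          filter_upwards [measure_eq_zero_iff_ae_notMem.1 hE.length_eq_zero] with ζ hζ
          exact rpow_inverseSquarePotential_le hp0 hp μ hE.isClosed hne hμ hζ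
      _ < ∞ := by
          rw [lintegral_add_left (by fun_prop), lintegral_const_mul' _ _ (by simp),
            lintegral_const_mul' _ _ (by simp)]
          exact ENNReal.add_lt_top.2 ⟨ENNReal.mul_lt_top (by simp) h2,
            ENNReal.mul_lt_top (by simp) h1⟩

/-! ### Differentiation of measures on the circle. -/

/-- The inclusion of the unit circle in the plane. -/
def circleToComplex (ζ : Circle) : ℂ := ζ

theorem measurableEmbedding_circleToComplex : MeasurableEmbedding circleToComplex := by
  have h : Continuous circleToComplex := by
    unfold circleToComplex
    fun_prop
  exact (h.isClosedEmbedding fun _ _ ↦ Circle.ext).measurableEmbedding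

/-- Closed balls of the circle are traces of planar closed balls with the same centre, so
Besicovitch differentiation in the plane applies to the push-forwards. -/
theorem map_circleToComplex_closedBall (μ : Measure Circle) (ζ : Circle) (h : ℝ) :
    μ.map circleToComplex (closedBall (circleToComplex ζ) h) = μ (closedBall ζ h) := by
  rw [measurableEmbedding_circleToComplex.map_apply]
  rfl

theorem ae_tendsto_closedBall_div (ρ μ : Measure Circle) [IsFiniteMeasure ρ]
    [IsFiniteMeasure μ] :
    ∀ᵐ ζ ∂μ, Tendsto (fun h ↦ ρ (closedBall ζ h) / μ (closedBall ζ h)) (𝓝[>] 0)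
      (𝓝 ((ρ.map circleToComplex).rnDeriv (μ.map circleToComplex) (circleToComplex ζ))) := by
  have h := Besicovitch.ae_tendsto_rnDeriv (ρ.map circleToComplex) (μ.map circleToComplex)
  rw [measurableEmbedding_circleToComplex.ae_map_iff] at h
  simpa only [map_circleToComplex_closedBall] using h

theorem ae_exists_tendsto_closedBall_div (ρ μ : Measure Circle) [IsFiniteMeasure ρ]
    [IsFiniteMeasure μ] :
    ∀ᵐ ζ ∂μ, ∃ L : ℝ≥0∞, L < ∞ ∧
      Tendsto (fun h ↦ ρ (closedBall ζ h) / μ (closedBall ζ h)) (𝓝[>] 0) (𝓝 L) := by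
  have h := Measure.rnDeriv_lt_top (ρ.map circleToComplex) (μ.map circleToComplex)
  rw [measurableEmbedding_circleToComplex.ae_map_iff] at h
  filter_upwards [h, ae_tendsto_closedBall_div ρ μ] with ζ h1 h2
  exact ⟨_, h1, h2⟩

theorem ae_tendsto_closedBall_div_zero {ρ μ : Measure Circle} [IsFiniteMeasure ρ]
    [IsFiniteMeasure μ] (hs : ρ ⟂ₘ μ) :
    ∀ᵐ ζ ∂μ, Tendsto (fun h ↦ ρ (closedBall ζ h) / μ (closedBall ζ h)) (𝓝[>] 0) (𝓝 0) := by
  have hs' : ρ.map circleToComplex ⟂ₘ μ.map circleToComplex := by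
    obtain ⟨s, hs, h1, h2⟩ := hs
    refine ⟨_, measurableEmbedding_circleToComplex.measurableSet_image.2 hs, ?_, ?_⟩
    · rw [measurableEmbedding_circleToComplex.map_apply,
        preimage_image_eq _ measurableEmbedding_circleToComplex.injective, h1]
    · rw [measurableEmbedding_circleToComplex.map_apply, preimage_compl,
        preimage_image_eq _ measurableEmbedding_circleToComplex.injective, h2]
  have h := (Measure.rnDeriv_eq_zero _ _).2 hs'
  have h' := measurableEmbedding_circleToComplex.ae_map_iff.1 h
  filter_upwards [h', ae_tendsto_closedBall_div ρ μ] with ζ h1 h2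
  rwa [h1] at h2

/-! ### The sets where the inner function is small up to the boundary. -/

theorem le_inverseSquarePotential_smul (μ : Measure Circle) (ξ : Circle) {h : ℝ} (h0 : 0 < h) :
    ENNReal.ofReal (1 / (4 * h ^ 2)) * μ (closedBall ξ h) ≤
      inverseSquarePotential μ ((1 - h : ℝ) * ξ) := by
  rw [inverseSquarePotential, ← setLIntegral_const]
  refine le_trans (setLIntegral_mono' measurableSet_closedBall fun η hη ↦ ?_)
    (setLIntegral_le_lintegral _ _)
  rw [mem_closedBall, Circle.dist_eq_norm] at hη
  have h1 : ‖(η : ℂ) - (1 - h : ℝ) * ξ‖ ≤ 2 * h := by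
    have e : (η : ℂ) - (1 - h : ℝ) * ξ = ((η : ℂ) - ξ) + (h : ℂ) * ξ := by push_cast; ring
    rw [e, two_mul]
    refine (norm_add_le _ _).trans (add_le_add hη ?_)
    rw [norm_smul_circle h0.le]
  rw [← ofReal_norm, one_div, show 4 * h ^ 2 = (2 * h) ^ 2 by ring,
    ENNReal.ofReal_inv_of_pos (by positivity), ENNReal.ofReal_pow (by positivity)]
  gcongr

/-- At almost every point for a singular μ, small balls have far more mass than length, which makes
the potential large compared with the inverse of the height. -/
theorem ae_exists_norm_singularInner_le {μ : Measure Circle} [IsFiniteMeasure μ]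
    (hs : μ ⟂ₘ circleArcLength) :
    ∀ᵐ ξ : Circle ∂μ, ∃ δ > (0 : ℝ), ∀ r ∈ Ico (1 - δ) 1,
      ‖singularInner μ (r * ξ)‖ ≤ Real.exp (-8) := by
  filter_upwards [ae_tendsto_closedBall_div_zero hs.symm] with ξ hξ
  -- Mass at least 32h in the ball of radius h gives V ≥ 32h / (4h²) = 8/h, hence the exponent 8.
  have h1 : ∀ᶠ h in 𝓝[>] (0 : ℝ), circleArcLength (closedBall ξ h) / μ (closedBall ξ h) <
      ENNReal.ofReal (1 / 32) := hξ.eventually_lt_const (by simp)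
  obtain ⟨ε, hε, h2⟩ := (mem_nhdsGT_iff_exists_Ioo_subset).1 h1
  rw [mem_Ioi] at hε
  refine ⟨min (ε / 2) 1, by positivity, fun r hr ↦ ?_⟩
  have hr1 : 1 - r ≤ ε / 2 := by linarith [hr.1, min_le_left (ε / 2) 1]
  have hr2 : 1 - r ≤ 1 := by linarith [hr.1, min_le_right (ε / 2) 1]
  have hr3 : 0 < 1 - r := by linarith [hr.2]
  have h3 := h2 (show 1 - r ∈ Ioo 0 ε from ⟨hr3, by linarith⟩)
  have h4 : ENNReal.ofReal (1 - r) ≤ ENNReal.ofReal (1 / 32) * μ (closedBall ξ (1 - r)) := by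
    refine (le_circleArcLength_closedBall ξ hr2).trans ?_
    rw [mem_ofPred_eq] at h3
    by_cases h0 : μ (closedBall ξ (1 - r)) = 0
    · have h5 : circleArcLength (closedBall ξ (1 - r)) ≠ 0 := by
        have := le_circleArcLength_closedBall ξ hr2
        intro h'
        rw [h'] at this
        simp at this
        linarith
      rw [h0, ENNReal.div_zero h5] at h3
      exact absurd h3 not_top_lt
    · exact ((ENNReal.div_lt_iff (Or.inl h0) (Or.inl (measure_ne_top _ _))).1 h3).le
  have hn := norm_smul_circle (r := r) (by linarith) ξ
  have h6 := le_inverseSquarePotential_smul μ ξ hr3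
  rw [sub_sub_cancel] at h6
  have hV := inverseSquarePotential_lt_top μ (z := r * ξ) (by rw [hn]; exact hr.2)
  rw [norm_singularInner μ (by rw [hn]; exact hr.2), hn]
  rw [← ENNReal.ofReal_toReal hV.ne, ← ENNReal.ofReal_toReal (measure_ne_top μ (closedBall ξ (1 - r))),
    ← ENNReal.ofReal_mul (by positivity), ENNReal.ofReal_le_ofReal_iff ENNReal.toReal_nonneg] at h6
  rw [← ENNReal.ofReal_toReal (measure_ne_top μ (closedBall ξ (1 - r))),
    ← ENNReal.ofReal_mul (by positivity), ENNReal.ofReal_le_ofReal_iff (by positivity)] at h4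
  set v := (inverseSquarePotential μ (r * ξ)).toReal
  set m := (μ (closedBall ξ (1 - r))).toReal
  apply Real.exp_le_exp.2
  have h7 : 8 / (1 - r) ≤ v := by
    refine le_trans ?_ h6
    rw [one_div, ← div_eq_inv_mul, div_le_div_iff₀ hr3 (by positivity)]
    nlinarith
  rw [div_le_iff₀ hr3] at h7
  nlinarith [mul_nonneg (mul_nonneg hr3.le (by linarith : 0 ≤ r)) (by positivity : 0 ≤ v)]

/-- The boundary points at which `|S_μ| ≤ e⁻⁸` on the last part of the radius. -/
def smallRadii (μ : Measure Circle) (j : ℕ) : Set Circle :=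
  {ξ | ∀ r ∈ Ico (1 - 1 / ((j : ℝ) + 2)) 1, ‖singularInner μ ((r : ℝ) * ξ)‖ ≤ Real.exp (-8)}

theorem one_div_add_two_le (j : ℕ) : 1 / ((j : ℝ) + 2) ≤ 1 / 2 := by
  have : (0 : ℝ) ≤ j := j.cast_nonneg
  gcongr
  linarith

theorem isClosed_smallRadii (μ : Measure Circle) [IsFiniteMeasure μ] (j : ℕ) :
    IsClosed (smallRadii μ j) := by
  rw [smallRadii]
  have : {ξ : Circle | ∀ r ∈ Ico (1 - 1 / ((j : ℝ) + 2)) 1,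
      ‖singularInner μ ((r : ℝ) * ξ)‖ ≤ Real.exp (-8)} =
      ⋂ r ∈ Ico (1 - 1 / ((j : ℝ) + 2)) 1,
        {ξ : Circle | ‖singularInner μ ((r : ℝ) * ξ)‖ ≤ Real.exp (-8)} := by
    ext
    simp
  rw [this]
  refine isClosed_biInter fun r hr ↦ isClosed_le (Continuous.norm ?_) continuous_const
  refine (differentiableOn_singularInner μ).continuousOn.comp_continuous (by fun_prop) fun ξ ↦ ?_
  rw [mem_ball_zero_iff, norm_smul_circle (by linarith [hr.1, one_div_add_two_le j])]
  exact hr.2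

theorem ae_mem_iUnion_smallRadii {μ : Measure Circle} [IsFiniteMeasure μ]
    (hs : μ ⟂ₘ circleArcLength) : ∀ᵐ ξ ∂μ, ξ ∈ ⋃ j, smallRadii μ j := by
  filter_upwards [ae_exists_norm_singularInner_le hs] with ξ ⟨δ, hδ, h⟩
  obtain ⟨j, hj⟩ := exists_nat_one_div_lt hδ
  refine mem_iUnion.2 ⟨j, fun r hr ↦ h r ⟨?_, hr.2⟩⟩
  have : 1 / ((j : ℝ) + 2) ≤ 1 / (j + 1) := by
    have : (0 : ℝ) ≤ j := j.cast_nonneg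
    gcongr
    linarith
  linarith [hr.1]

theorem inverseSquarePotential_smul_le_of_norm_sub_le (μ : Measure Circle) {ζ ξ : Circle} {r : ℝ}
    (hr0 : 0 ≤ r) (hr : r ≤ 1) (h : ‖(ζ : ℂ) - ξ‖ ≤ 1 - r) :
    inverseSquarePotential μ (r * ξ) ≤ 4 * inverseSquarePotential μ (r * ζ) := by
  rw [inverseSquarePotential, inverseSquarePotential, ← lintegral_const_mul' _ _ (by simp)]
  refine lintegral_mono fun η ↦ ?_
  have h1 : ‖(η : ℂ) - r * ζ‖ₑ ≤ 2 * ‖(η : ℂ) - r * ξ‖ₑ := by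
    simp_rw [← ofReal_norm]
    rw [show (2 : ℝ≥0∞) = ENNReal.ofReal 2 by simp, ← ENNReal.ofReal_mul (by norm_num)]
    apply ENNReal.ofReal_le_ofReal
    have e : (η : ℂ) - r * ζ = ((η : ℂ) - r * ξ) - (r : ℂ) * (ζ - ξ) := by ring
    have h2 := one_sub_norm_le_norm_sub η (r * ξ)
    rw [norm_smul_circle hr0] at h2
    have h3 : ‖(r : ℂ) * (ζ - ξ)‖ ≤ 1 * (1 - r) := by
      rw [norm_mul, Complex.norm_real, Real.norm_of_nonneg hr0]
      gcongr
    rw [e]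
    refine (norm_sub_le _ _).trans ?_
    linarith
  calc (‖(η : ℂ) - r * ξ‖ₑ ^ 2)⁻¹ = 4 * ((2 * ‖(η : ℂ) - r * ξ‖ₑ) ^ 2)⁻¹ := by
        rw [mul_pow, ENNReal.mul_inv (by simp) (by simp), ← mul_assoc,
          show (2 : ℝ≥0∞) ^ 2 = 4 by norm_num, ENNReal.mul_inv_cancel (by simp) (by simp), one_mul]
    _ ≤ _ := by gcongr

/-- At heights above the distance d to the nearest point ξ of the set, V(rξ) ≤ 4V(rζ). The bound e⁻⁸
at rξ therefore gives at most e⁻² at rζ, below the threshold e⁻¹. Far from the set the first term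
suffices. -/
theorem infEDist_smallRadii_rpow_le {p : ℝ} (hp0 : 0 < p) (hp : p < 1) (μ : Measure Circle)
    [IsFiniteMeasure μ] {j : ℕ} (hne : (smallRadii μ j).Nonempty) (ζ : Circle) :
    infEDist ζ (smallRadii μ j) ^ (-p) ≤
      ENNReal.ofReal (1 / (2 * ((j : ℝ) + 2))) ^ (-p) +
        8 * radialArea (1 + p) μ (Real.exp (-1)) ζ := by
  obtain ⟨ξ, hξ, he⟩ := (isClosed_smallRadii μ j).isCompact.exists_infEDist_eq_edist hne ζ
  rw [he, Circle.edist_eq_ofReal]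
  set d := ‖(ζ : ℂ) - ξ‖
  have hd0 : 0 ≤ d := norm_nonneg _
  have hj := one_div_add_two_le j
  have e : 1 / (2 * ((j : ℝ) + 2)) = 1 / ((j : ℝ) + 2) / 2 := by
    rw [div_div, mul_comm]
  rw [e]
  have hδ0 : 0 < 1 / ((j : ℝ) + 2) := by positivity
  set δ := 1 / ((j : ℝ) + 2) with hδ
  rcases le_or_gt (δ / 2) d with h | h
  · refine le_trans (ENNReal.rpow_neg_le_rpow_neg hp0.le ?_) le_self_add
    exact ENNReal.ofReal_le_ofReal h
  · refine le_trans ?_ le_add_self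
    -- The bound is proved for a > d and a tends to d. This also covers d = 0, where the left side
    -- is infinite.
    have hlim : Tendsto (fun a ↦ ENNReal.ofReal a ^ (-p)) (𝓝[>] d) (𝓝 (ENNReal.ofReal d ^ (-p))) :=
      ((ENNReal.continuous_rpow_const.comp ENNReal.continuous_ofReal).tendsto d).mono_left
        nhdsWithin_le_nhds
    refine le_of_tendsto hlim ?_
    filter_upwards [Ioo_mem_nhdsGT h] with a ha
    have ha0 : 0 < a := hd0.trans_lt ha.1
    rw [ENNReal.ofReal_rpow_of_pos ha0]
    refine ofReal_rpow_neg_le_radialArea hp0 hp ha0 (by linarith [ha.2]) fun r hr ↦ ?_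
    have hr0 : 0 ≤ r := by linarith [hr.1, ha.2]
    have hr1 : r < 1 := by linarith [hr.2]
    have hn := norm_smul_circle hr0 ζ
    have hn' := norm_smul_circle hr0 ξ
    have h1 := hξ r ⟨by linarith [hr.1, ha.2], hr1⟩
    have h2 := inverseSquarePotential_smul_le_of_norm_sub_le μ (ζ := ζ) (ξ := ξ) hr0 hr1.le
      (show d ≤ 1 - r by linarith [hr.2, ha.1])
    have hV := inverseSquarePotential_lt_top μ (z := r * ζ) (by rw [hn]; exact hr1)
    have hV' := inverseSquarePotential_lt_top μ (z := r * ξ) (by rw [hn']; exact hr1)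
    rw [norm_singularInner μ (by rw [hn']; exact hr1), hn', Real.exp_le_exp] at h1
    rw [norm_singularInner μ (by rw [hn]; exact hr1), hn, Real.exp_lt_exp]
    have h3 := ENNReal.toReal_mono (ENNReal.mul_ne_top (by simp) hV.ne) h2
    rw [ENNReal.toReal_mul, ENNReal.toReal_ofNat] at h3
    have h4 : 0 ≤ 1 - r ^ 2 := by nlinarith
    nlinarith [mul_le_mul_of_nonneg_left h3 h4]

theorem AreaCondition.isBeurlingCarleson_smallRadii {p : ℝ} (hp0 : 0 < p) (hp : p < 1)
    {μ : Measure Circle} [IsFiniteMeasure μ] (hA : AreaCondition (1 + p) μ) {j : ℕ}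
    (hne : (smallRadii μ j).Nonempty) : IsBeurlingCarleson (1 - p) (smallRadii μ j) := by
  refine .of_lintegral_infEDist_lt_top hp0 (isClosed_smallRadii μ j) hne ?_
  refine lt_of_le_of_lt (lintegral_mono (infEDist_smallRadii_rpow_le hp0 hp μ hne)) ?_
  rw [lintegral_add_left measurable_const, lintegral_const, lintegral_const_mul' _ _ (by simp)]
  refine ENNReal.add_lt_top.2 ⟨ENNReal.mul_lt_top ?_ (measure_lt_top _ _),
    ENNReal.mul_lt_top (by simp)
      ((areaCondition_iff _ _).1 hA _ (Real.exp_pos _) (by simp))⟩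
  rw [ENNReal.ofReal_rpow_of_pos (by positivity)]
  exact ENNReal.ofReal_lt_top

/-! ### Cutting a singular measure into pieces with derivative in the Hardy space. -/

theorem AreaCondition.mono {s : ℝ} {μ ν : Measure Circle} [IsFiniteMeasure μ] [IsFiniteMeasure ν]
    (hA : AreaCondition s μ) (h : ν ≤ μ) : AreaCondition s ν := by
  intro c hc0 hc
  refine lt_of_le_of_lt (lintegral_mono_set ?_) (hA c hc0 hc)
  rintro z ⟨hz, hz'⟩
  refine ⟨hz, lt_of_le_of_lt ?_ hz'⟩
  rw [norm_singularInner μ hz, norm_singularInner ν hz, Real.exp_le_exp, neg_le_neg_iff]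
  have h0 : 0 ≤ 1 - ‖z‖ ^ 2 := by nlinarith [norm_nonneg z]
  gcongr
  · exact (inverseSquarePotential_lt_top μ hz).ne
  · exact inverseSquarePotential_mono h z

/-- Disjointing the sets `smallRadii μ j` gives pieces that live on Beurling–Carleson sets, inherit
the area condition by monotonicity, and exhaust μ. -/
theorem AreaCondition.upToCountableSums_memHardy {p : ℝ} (hp0 : 0 < p) (hp : p < 1)
    {μ : Measure Circle} [IsFiniteMeasure μ] (hs : μ ⟂ₘ circleArcLength)
    (hA : AreaCondition (1 + p) μ) :
    UpToCountableSums (fun ν ↦ MemHardy p (deriv (singularInner ν))) μ := by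
  have hm (j : ℕ) : MeasurableSet (disjointed (smallRadii μ) j) :=
    MeasurableSet.disjointed (fun i ↦ (isClosed_smallRadii μ i).measurableSet) j
  refine ⟨fun j ↦ μ.restrict (disjointed (smallRadii μ) j), fun j ↦ ⟨inferInstance, ?_⟩, ?_⟩
  · apply memHardy_deriv_of_lintegral_potential_lt_top hp0
    rcases (smallRadii μ j).eq_empty_or_nonempty with he | hne
    · have : disjointed (smallRadii μ) j = ∅ :=
        subset_empty_iff.1 ((disjointed_subset (smallRadii μ) j).trans he.le)
      simp [this, inverseSquarePotential, hp0]
    · refine lintegral_potential_lt_top_of_isBeurlingCarleson hp0 hp _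
        (hA.isBeurlingCarleson_smallRadii hp0 hp hne) ?_ (hA.mono Measure.restrict_le_self)
      rw [Measure.restrict_apply (isClosed_smallRadii μ j).measurableSet.compl]
      refine measure_mono_null (fun x hx ↦ ?_) measure_empty
      exact hx.1 (disjointed_subset _ _ hx.2)
  · rw [← Measure.restrict_iUnion (disjoint_disjointed _) hm, iUnion_disjointed]
    exact (Measure.restrict_eq_self_of_ae_mem (ae_mem_iUnion_smallRadii hs)).symm

theorem UpToCountableSums.bind {P : Measure Circle → Prop} {μ : Measure Circle}
    {ν : ℕ → Measure Circle} (hμ : μ = Measure.sum ν) (h : ∀ k, UpToCountableSums P (ν k)) :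
    UpToCountableSums P μ := by
  choose κ hκ hsum using h
  refine ⟨fun n ↦ κ n.unpair.1 n.unpair.2, fun n ↦ hκ _ _, ?_⟩
  ext s hs
  rw [hμ, Measure.sum_apply _ hs, Measure.sum_apply _ hs]
  calc ∑' k, ν k s = ∑' (k) (j), κ k j s := by
        congr 1
        ext k
        rw [hsum k, Measure.sum_apply _ hs]
    _ = ∑' q : ℕ × ℕ, κ q.1 q.2 s := ENNReal.tsum_prod.symm
    _ = _ := (Nat.pairEquiv.symm.tsum_eq fun q : ℕ × ℕ ↦ κ q.1 q.2 s).symm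

/-! ### Poisson majorants of |f|^p. -/

theorem circleAverage_eq_integral_circleArcLength {E : Type*} [NormedAddCommGroup E]
    [NormedSpace ℝ E] {f : ℂ → E} (hf : Continuous fun ζ : Circle ↦ f ζ) :
    Real.circleAverage f 0 1 = (2 * π)⁻¹ • ∫ ζ : Circle, f ζ ∂circleArcLength := by
  have hper : Function.Periodic (fun θ : ℝ ↦ f (Circle.exp θ)) (2 * π) := fun θ ↦ by
    simp only [Circle.exp_add_two_pi]
  rw [Real.circleAverage, circleArcLength, integral_map Circle.exp.continuous.aemeasurable
    hf.aestronglyMeasurable_of_compactSpace, ← intervalIntegral.integral_of_le (by linarith [Real.pi_pos])]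
  have h := hper.intervalIntegral_add_eq 0 (-π)
  rw [zero_add, show -π + 2 * π = π by ring] at h
  rw [← h]
  congr 1
  refine intervalIntegral.integral_congr fun θ _ ↦ ?_
  simp [circleMap, Circle.coe_exp]

/-- A trigonometric polynomial has the form q₁ + conj q₂ on the circle with q₁, q₂ entire, and its
real part equals that of q₁ + q₂. -/
theorem exists_differentiable_re_near (φ : C(Circle, ℝ)) {ε : ℝ} (hε : 0 < ε) :
    ∃ q : ℂ → ℂ, Differentiable ℂ q ∧ ∀ ζ : Circle, |(q ζ).re - φ ζ| ≤ ε := by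
  have : Fact (0 < 2 * π) := ⟨by positivity⟩
  have hcirc (n : ℤ) (θ : ℝ) : fourier n (θ : AddCircle (2 * π)) = (Circle.exp θ : ℂ) ^ n := by
    rw [fourier_apply, AddCircle.toCircle_zsmul, AddCircle.toCircle_apply_mk, Circle.coe_zpow]
    congr 3
    field_simp
  let f : C(AddCircle (2 * π), ℂ) :=
    ⟨fun x ↦ φ (AddCircle.homeomorphCircle' x), by fun_prop⟩
  have hf : f ∈ (Submodule.span ℂ (range (fourier (T := 2 * π)))).topologicalClosure := by
    rw [span_fourier_closure_eq_top]
    trivial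
  obtain ⟨g, hg, hfg⟩ := Metric.mem_closure_iff.1 hf ε hε
  obtain ⟨q₁, q₂, h1, h2, h⟩ : ∃ q₁ q₂ : ℂ → ℂ, Differentiable ℂ q₁ ∧ Differentiable ℂ q₂ ∧
      ∀ θ : ℝ, g (θ : AddCircle (2 * π)) =
        q₁ (Circle.exp θ) + (starRingEnd ℂ) (q₂ (Circle.exp θ)) := by
    clear hfg
    induction hg using Submodule.span_induction with
    | mem x hx =>
      obtain ⟨n, rfl⟩ := hx
      obtain ⟨k, rfl | rfl⟩ := n.eq_nat_or_neg
      · exact ⟨fun z ↦ z ^ k, 0, by fun_prop, by fun_prop, fun θ ↦ by simp [hcirc]⟩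
      · refine ⟨0, fun z ↦ z ^ k, by fun_prop, by fun_prop, fun θ ↦ ?_⟩
        rw [fourier_neg, hcirc]
        simp
    | zero => exact ⟨0, 0, by fun_prop, by fun_prop, fun θ ↦ by simp⟩
    | add x y _ _ hx hy =>
      obtain ⟨a, b, ha, hb, hx⟩ := hx
      obtain ⟨c, d, hc, hd, hy⟩ := hy
      refine ⟨a + c, b + d, ha.add hc, hb.add hd, fun θ ↦ ?_⟩
      simp only [ContinuousMap.add_apply, Pi.add_apply, map_add, hx, hy]
      ring
    | smul c x _ hx =>
      obtain ⟨a, b, ha, hb, hx⟩ := hx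
      refine ⟨c • a, (starRingEnd ℂ) c • b, ha.const_smul _, hb.const_smul _, fun θ ↦ ?_⟩
      simp only [ContinuousMap.smul_apply, Pi.smul_apply, hx, smul_eq_mul, map_mul,
        Complex.conj_conj]
      ring
  refine ⟨q₁ + q₂, h1.add h2, fun ζ ↦ ?_⟩
  obtain ⟨θ, rfl⟩ := Circle.exp_surjective ζ
  have h3 : ‖f (θ : AddCircle (2 * π)) - g θ‖ ≤ ε := by
    rw [← dist_eq_norm]
    exact (ContinuousMap.dist_apply_le_dist _).trans hfg.le
  have h4 := (Complex.abs_re_le_norm _).trans h3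
  rw [h] at h4
  have h5 : f (θ : AddCircle (2 * π)) = φ (Circle.exp θ) := rfl
  rw [h5] at h4
  rw [abs_sub_comm]
  simpa using h4

theorem circle_average_poisson {f : ℂ → ℂ} (hf : DiffContOnCl ℂ f (ball 0 1)) {a : ℂ}
    (ha : ‖a‖ < 1) :
    f a = (2 * π)⁻¹ • ∫ ζ : Circle, ((1 - ‖a‖ ^ 2) * (‖(ζ : ℂ) - a‖ ^ 2)⁻¹) • f ζ
      ∂circleArcLength := by
  have hfc : Continuous fun ζ : Circle ↦ f ζ :=
    hf.continuousOn.comp_continuous (by fun_prop) fun ζ ↦ by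
      rw [closure_ball _ one_ne_zero, mem_closedBall_zero_iff, Circle.norm_coe]
  have h := hf.circleAverage_poissonKernel_smul' (w := a) (by simpa using ha)
  have hc : Continuous fun ζ : Circle ↦
      ((‖(ζ : ℂ) - 0‖ ^ 2 - ‖a - 0‖ ^ 2) / ‖((ζ : ℂ) - 0) - (a - 0)‖ ^ 2) • f ζ := by
    have hd : Continuous fun ζ : Circle ↦
        (‖(ζ : ℂ) - 0‖ ^ 2 - ‖a - 0‖ ^ 2) / ‖((ζ : ℂ) - 0) - (a - 0)‖ ^ 2 := by
      refine Continuous.div (by fun_prop) (by fun_prop) fun ζ ↦ ?_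
      simpa using ζ.sub_ne_zero_of_norm_lt_one ha
    exact hd.smul hfc
  rw [circleAverage_eq_integral_circleArcLength hc] at h
  rw [← h]
  simp only [sub_zero, Circle.norm_coe, one_pow, div_eq_mul_inv]

/-- Subharmonicity of |f|^p for every p > 0, without dividing out zeros. Choose an entire q with Re
q close to log(|f|^p + ε) on the circle; the maximum principle for f·exp(-q/p) bounds |f(a)|^p by
|exp q(a)|, and the Poisson formula for exp q returns to |f|^p + ε, up to factors exp ε. -/
theorem rpow_norm_le_poisson {p : ℝ} (hp0 : 0 < p) {f : ℂ → ℂ}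
    (hf : DiffContOnCl ℂ f (ball 0 1)) {a : ℂ} (ha : ‖a‖ < 1) :
    ‖f a‖ ^ p ≤ (2 * π)⁻¹ * ∫ ζ : Circle,
      (1 - ‖a‖ ^ 2) * (‖(ζ : ℂ) - a‖ ^ 2)⁻¹ * ‖f ζ‖ ^ p ∂circleArcLength := by
  have hfc : Continuous fun ζ : Circle ↦ f ζ :=
    hf.continuousOn.comp_continuous (by fun_prop) fun ζ ↦ by
      rw [closure_ball _ one_ne_zero, mem_closedBall_zero_iff, Circle.norm_coe]
  set P : Circle → ℝ := fun ζ ↦ (1 - ‖a‖ ^ 2) * (‖(ζ : ℂ) - a‖ ^ 2)⁻¹ with hP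
  have hPc : Continuous P := by
    refine continuous_const.mul (Continuous.inv₀ (by fun_prop) fun ζ ↦ ?_)
    simpa using ζ.sub_ne_zero_of_norm_lt_one ha
  have hP0 (ζ : Circle) : 0 ≤ P ζ := by
    have : 0 ≤ 1 - ‖a‖ ^ 2 := by nlinarith [norm_nonneg a]
    positivity
  have hint {g : Circle → ℝ} (hg : Continuous g) : Integrable g circleArcLength :=
    hg.integrable_of_hasCompactSupport (HasCompactSupport.of_compactSpace _)
  have hpc : Continuous fun ζ : Circle ↦ ‖f ζ‖ ^ p := hfc.norm.rpow_const fun _ ↦ Or.inr hp0.le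
  have hP1 : (2 * π)⁻¹ * ∫ ζ, P ζ ∂circleArcLength = 1 := by
    have h := circle_average_poisson (f := fun _ ↦ 1) diffContOnCl_const ha
    simp only [Complex.real_smul, mul_one] at h
    rw [integral_complex_ofReal] at h
    exact_mod_cast h.symm
  have key (ε : ℝ) (hε : 0 < ε) : ‖f a‖ ^ p ≤ Real.exp (2 * ε) *
      ((2 * π)⁻¹ * (∫ ζ : Circle, P ζ * ‖f ζ‖ ^ p ∂circleArcLength) + ε) := by
    obtain ⟨q, hq, hqφ⟩ := exists_differentiable_re_near
      ⟨fun ζ ↦ Real.log (‖f ζ‖ ^ p + ε), Continuous.log (by fun_prop) fun ζ ↦ by positivity⟩ hε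
    simp only [ContinuousMap.coe_mk] at hqφ
    have hmax : ‖f a * Complex.exp (-q a / p)‖ ≤ Real.exp (ε / p) := by
      refine Complex.norm_le_of_forall_mem_frontier_norm_le
        (isBounded_ball (x := 0) (r := 1))
        (f := fun z ↦ f z * Complex.exp (-q z / p)) ?_ ?_ (subset_closure (by simpa using ha))
      · have he : Differentiable ℂ fun z ↦ Complex.exp (-q z / p) := by fun_prop
        exact ⟨hf.differentiableOn.mul he.differentiableOn,
          hf.continuousOn.mul he.continuous.continuousOn⟩
      · intro z hz
        rw [frontier_ball _ one_ne_zero, mem_sphere_zero_iff_norm] at hz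
        obtain ⟨ζ, rfl⟩ : ∃ ζ : Circle, (ζ : ℂ) = z := ⟨⟨z, mem_sphere_zero_iff_norm.2 hz⟩, rfl⟩
        have h1 := (abs_le.1 (hqφ ζ)).1
        -- Zeros of f are set aside: there `Real.log` takes the default value 0 and the inequality
        -- may fail.
        have h2 : Real.log (‖f ζ‖ ^ p) ≤ (q ζ).re + ε ∨ ‖f ζ‖ = 0 := by
          rcases (norm_nonneg (f ζ)).eq_or_lt with h0 | h0
          · exact Or.inr h0.symm
          · left
            have : Real.log (‖f ζ‖ ^ p) ≤ Real.log (‖f ζ‖ ^ p + ε) :=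
              Real.log_le_log (by positivity) (by linarith)
            linarith
        rw [norm_mul, Complex.norm_exp, Complex.div_ofReal_re, Complex.neg_re]
        rcases h2 with h2 | h2
        · rcases (norm_nonneg (f ζ)).eq_or_lt with h0 | h0
          · rw [← h0, zero_mul]
            positivity
          · rw [Real.log_rpow h0] at h2
            rw [← Real.exp_log h0, ← Real.exp_add, Real.exp_le_exp, ← le_sub_iff_add_le,
              ← sub_div, le_div_iff₀ hp0]
            linarith
        · rw [h2, zero_mul]
          positivity
    rw [norm_mul, Complex.norm_exp, Complex.div_ofReal_re, Complex.neg_re] at hmax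
    have h1 : ‖f a‖ ^ p ≤ Real.exp ε * Real.exp (q a).re := by
      have h2 : ‖f a‖ ≤ Real.exp ((ε + (q a).re) / p) := by
        rw [neg_div, Real.exp_neg, ← div_eq_mul_inv, div_le_iff₀ (Real.exp_pos _),
          ← Real.exp_add, ← add_div] at hmax
        exact hmax
      calc ‖f a‖ ^ p ≤ Real.exp ((ε + (q a).re) / p) ^ p := by gcongr
        _ = _ := by rw [← Real.exp_mul, div_mul_cancel₀ _ hp0.ne', Real.exp_add]
    have hec : Differentiable ℂ fun z ↦ Complex.exp (q z) := hq.cexp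
    have h2 : Real.exp (q a).re ≤
        (2 * π)⁻¹ * ∫ ζ : Circle, P ζ * Real.exp (q ζ).re ∂circleArcLength := by
      rw [← Complex.norm_exp, circle_average_poisson hec.diffContOnCl ha, norm_smul,
        Real.norm_of_nonneg (by positivity)]
      gcongr
      refine (norm_integral_le_integral_norm _).trans (le_of_eq ?_)
      refine integral_congr_ae (ae_of_all _ fun ζ ↦ ?_)
      simp only [norm_smul, Complex.norm_exp]
      rw [Real.norm_of_nonneg (hP0 ζ)]
    have hqc : Continuous fun ζ : Circle ↦ Real.exp (q ζ).re :=
      Real.continuous_exp.comp (Complex.continuous_re.comp (hq.continuous.comp (by fun_prop)))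
    have h3 : ∫ ζ : Circle, P ζ * Real.exp (q ζ).re ∂circleArcLength ≤
        ∫ ζ : Circle, Real.exp ε * (P ζ * ‖f ζ‖ ^ p + ε * P ζ) ∂circleArcLength := by
      refine integral_mono (hint (by fun_prop)) (hint (by fun_prop)) fun ζ ↦ ?_
      have h4 := (abs_le.1 (hqφ ζ)).2
      have h5 : Real.exp (q ζ).re ≤ Real.exp ε * (‖f ζ‖ ^ p + ε) := by
        rw [← Real.exp_log (show 0 < ‖f ζ‖ ^ p + ε by positivity), ← Real.exp_add, Real.exp_le_exp]
        linarith
      calc P ζ * Real.exp (q ζ).re ≤ P ζ * (Real.exp ε * (‖f ζ‖ ^ p + ε)) := by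
            gcongr
            exact hP0 ζ
        _ = _ := by ring
    rw [integral_const_mul, integral_add (hint (by fun_prop)) (hint (by fun_prop)),
      integral_const_mul] at h3
    calc ‖f a‖ ^ p ≤ Real.exp ε * ((2 * π)⁻¹ * (Real.exp ε *
          (∫ ζ : Circle, P ζ * ‖f ζ‖ ^ p ∂circleArcLength + ε * ∫ ζ, P ζ ∂circleArcLength))) := by
          refine h1.trans ?_
          gcongr
          refine h2.trans ?_
          gcongr
      _ = Real.exp (2 * ε) * ((2 * π)⁻¹ * (∫ ζ : Circle, P ζ * ‖f ζ‖ ^ p ∂circleArcLength) +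
          ε * ((2 * π)⁻¹ * ∫ ζ, P ζ ∂circleArcLength)) := by
          rw [two_mul ε, Real.exp_add]
          ring
      _ = _ := by rw [hP1, mul_one]
  have hlim : Tendsto (fun ε ↦ Real.exp (2 * ε) *
      ((2 * π)⁻¹ * (∫ ζ : Circle, P ζ * ‖f ζ‖ ^ p ∂circleArcLength) + ε)) (𝓝[>] 0)
      (𝓝 (Real.exp (2 * 0) *
        ((2 * π)⁻¹ * (∫ ζ : Circle, P ζ * ‖f ζ‖ ^ p ∂circleArcLength) + 0))) := by
    refine Tendsto.mono_left (Continuous.tendsto ?_ 0) nhdsWithin_le_nhds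
    fun_prop
  rw [mul_zero, Real.exp_zero, one_mul, add_zero] at hlim
  exact ge_of_tendsto hlim (eventually_mem_nhdsWithin.mono fun ε hε ↦ key ε hε)

theorem tendsto_one_sub_one_div_add_two :
    Tendsto (fun n : ℕ ↦ 1 - 1 / ((n : ℝ) + 2)) atTop (𝓝[<] 1) := by
  refine tendsto_nhdsWithin_iff.2 ⟨?_, Eventually.of_forall fun n ↦ ?_⟩
  · have h : Tendsto (fun n : ℕ ↦ 1 / ((n : ℝ) + 2)) atTop (𝓝 0) :=
      tendsto_const_nhds.div_atTop (tendsto_atTop_add_const_right _ _ tendsto_natCast_atTop_atTop)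
    simpa using h.const_sub 1
  · have : (0 : ℝ) < 1 / ((n : ℝ) + 2) := by positivity
    rw [mem_Iio]
    linarith

theorem one_sub_one_div_add_two_mem (n : ℕ) : 1 - 1 / ((n : ℝ) + 2) ∈ Ico (0 : ℝ) 1 := by
  have h1 : (0 : ℝ) < 1 / ((n : ℝ) + 2) := by positivity
  have h2 := one_div_add_two_le n
  constructor <;> linarith

/-- The measures |f(Rζ)|^p dθ have bounded mass, so they have a weak limit m as R → 1; the Poisson
inequality passes to the limit, and the factor 1/(2π) ≤ 1 is dropped. -/
theorem MemHardy.exists_measure_majorant {p : ℝ} (hp0 : 0 < p) {f : ℂ → ℂ} (hf : MemHardy p f) :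
    ∃ m : Measure Circle, IsFiniteMeasure m ∧ ∀ a : ℂ, ‖a‖ < 1 →
      ENNReal.ofReal (‖f a‖ ^ p) ≤ ENNReal.ofReal (1 - ‖a‖ ^ 2) * inverseSquarePotential m a := by
  obtain ⟨hd, hK⟩ := hf
  set K := ⨆ r : Ico (0 : ℝ) 1, ∫⁻ ζ : Circle, ‖f ((r : ℝ) * (ζ : ℂ))‖ₑ ^ p ∂circleArcLength
  let R : ℕ → ℝ := fun n ↦ 1 - 1 / ((n : ℝ) + 2)
  have hR (n : ℕ) : R n ∈ Ico (0 : ℝ) 1 := one_sub_one_div_add_two_mem n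
  have hRlim : Tendsto R atTop (𝓝 1) := tendsto_one_sub_one_div_add_two.mono_right nhdsWithin_le_nhds
  have hmaps (n : ℕ) {z : ℂ} (hz : ‖z‖ ≤ 1) : (R n : ℂ) * z ∈ ball (0 : ℂ) 1 := by
    rw [mem_ball_zero_iff, norm_mul, Complex.norm_real, Real.norm_of_nonneg (hR n).1]
    nlinarith [(hR n).1, (hR n).2, norm_nonneg z]
  have hcont (n : ℕ) : Continuous fun ζ : Circle ↦ f (R n * ζ) :=
    hd.continuousOn.comp_continuous (by fun_prop) fun ζ ↦ hmaps n (Circle.norm_coe ζ).le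
  let d : ℕ → Circle → NNReal := fun n ζ ↦ ‖f (R n * ζ)‖₊ ^ p
  have hdc (n : ℕ) : Continuous (d n) := 
    (NNReal.continuous_rpow_const hp0.le).comp (hcont n).nnnorm
  have hdK (n : ℕ) : ∫⁻ ζ, d n ζ ∂circleArcLength ≤ K := by
    refine le_trans (le_of_eq ?_) (le_iSup _ ⟨R n, hR n⟩)
    refine lintegral_congr fun ζ ↦ ?_
    rw [ENNReal.coe_rpow_of_nonneg _ hp0.le]
    rfl
  have hfin (n : ℕ) : IsFiniteMeasure (circleArcLength.withDensity fun ζ ↦ (d n ζ : ℝ≥0∞)) :=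
    isFiniteMeasure_withDensity ((hdK n).trans_lt hK).ne
  let M : ℕ → FiniteMeasure Circle := fun n ↦ ⟨_, hfin n⟩
  have hM (n : ℕ) : (M n).mass ≤ K.toNNReal := by
    rw [← ENNReal.coe_le_coe, ENNReal.coe_toNNReal hK.ne, FiniteMeasure.ennreal_mass]
    refine le_trans (le_of_eq ?_) (hdK n)
    change (circleArcLength.withDensity fun ζ ↦ (d n ζ : ℝ≥0∞)) univ = _
    rw [withDensity_apply _ MeasurableSet.univ, setLIntegral_univ]
  -- The limit is taken along a nonprincipal ultrafilter, so compactness is enough and no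
  -- subsequence is extracted.
  obtain ⟨m, -, hm⟩ := (isCompact_setOfPred_finiteMeasure_le_of_compactSpace Circle
    K.toNNReal).ultrafilter_le_nhds ((hyperfilter ℕ).map M)
    (le_principal_iff.2 (Filter.mem_map.2 (univ_mem' hM)))
  have hm' : Tendsto M (hyperfilter ℕ) (𝓝 m) := hm
  rw [FiniteMeasure.tendsto_iff_forall_integral_tendsto] at hm'
  have hU : (hyperfilter ℕ : Filter ℕ) ≤ atTop := by
    rw [← Nat.cofinite_eq_atTop]
    exact hyperfilter_le_cofinite
  refine ⟨m, inferInstance, fun a ha ↦ ?_⟩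
  have hPc : Continuous fun ζ : Circle ↦ (1 - ‖a‖ ^ 2) * (‖(ζ : ℂ) - a‖ ^ 2)⁻¹ := by
    refine continuous_const.mul (Continuous.inv₀ (by fun_prop) fun ζ ↦ ?_)
    simpa using ζ.sub_ne_zero_of_norm_lt_one ha
  have hlim := (hm' (BoundedContinuousFunction.mkOfCompact ⟨_, hPc⟩)).const_mul (2 * π)⁻¹
  have hlim' : Tendsto (fun n ↦ ‖f (R n * a)‖ ^ p) (hyperfilter ℕ) (𝓝 (‖f a‖ ^ p)) := by
    have h1 : ContinuousAt f a := hd.continuousOn.continuousAt 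
      (isOpen_ball.mem_nhds (by simpa using ha))
    have h2 : Tendsto (fun n ↦ (R n : ℂ) * a) atTop (𝓝 a) := by
      have := ((Complex.continuous_ofReal.tendsto 1).comp hRlim).mul_const a
      simpa using this
    exact (((h1.tendsto.comp h2).norm).rpow_const (Or.inr hp0.le)).mono_left hU
  have hle (n : ℕ) : ‖f (R n * a)‖ ^ p ≤ (2 * π)⁻¹ *
      ∫ ζ : Circle, (1 - ‖a‖ ^ 2) * (‖(ζ : ℂ) - a‖ ^ 2)⁻¹ ∂(M n : Measure Circle) := by
    have hdiff : DiffContOnCl ℂ (fun z ↦ f (R n * z)) (ball 0 1) := by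
      have : DifferentiableOn ℂ (fun z ↦ f (R n * z)) (closedBall 0 1) :=
        hd.comp (by fun_prop) fun z hz ↦ hmaps n (mem_closedBall_zero_iff.1 hz)
      exact DifferentiableOn.diffContOnCl (by rwa [closure_ball _ one_ne_zero])
    refine (rpow_norm_le_poisson hp0 hdiff ha).trans (le_of_eq ?_)
    change _ = (2 * π)⁻¹ * ∫ ζ : Circle, (1 - ‖a‖ ^ 2) * (‖(ζ : ℂ) - a‖ ^ 2)⁻¹
      ∂(circleArcLength.withDensity fun ζ ↦ (d n ζ : ℝ≥0∞))
    rw [integral_withDensity_eq_integral_smul (hdc n).measurable]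
    congr 1
    refine integral_congr_ae (ae_of_all _ fun ζ ↦ ?_)
    simp only [d, NNReal.smul_def, smul_eq_mul, NNReal.coe_rpow, coe_nnnorm]
    ring
  have hfinal : ‖f a‖ ^ p ≤ (2 * π)⁻¹ *
      ∫ ζ : Circle, (1 - ‖a‖ ^ 2) * (‖(ζ : ℂ) - a‖ ^ 2)⁻¹ ∂(m : Measure Circle) :=
    le_of_tendsto_of_tendsto' hlim' hlim hle
  have h0 : 0 ≤ 1 - ‖a‖ ^ 2 := by nlinarith [norm_nonneg a]
  rw [(inverseSquarePotential_eq_ofReal m ha).2, ← ENNReal.ofReal_mul h0, ← integral_const_mul]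
  apply ENNReal.ofReal_le_ofReal
  refine hfinal.trans (mul_le_of_le_one_left (integral_nonneg fun ζ ↦ by positivity) ?_)
  exact inv_le_one_of_one_le₀ (by linarith [Real.pi_gt_three])

/-! ### Radial control of Poisson integrals. -/

/-- The Poisson integral is bounded by the maximal function: cover by balls of radius 2^k h with h =
1 - r. The k-th ball contributes at most 16B / (2^k h), the sum is 32B/h, and 1 - r² ≤ 2h. -/
theorem inverseSquarePotential_smul_le_of_closedBall_le {m : Measure Circle} {ζ : Circle}
    {B : ℝ≥0∞} (hB : ∀ h : ℝ, 0 < h → m (closedBall ζ h) ≤ B * ENNReal.ofReal h) {r : ℝ}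
    (hr0 : 0 ≤ r) (hr : r < 1) :
    ENNReal.ofReal (1 - r ^ 2) * inverseSquarePotential m (r * ζ) ≤ 64 * B := by
  set h := 1 - r with hh
  have h0 : 0 < h := by linarith
  have hpt (η : Circle) : (‖(η : ℂ) - r * ζ‖ₑ ^ 2)⁻¹ ≤
      ∑' k : ℕ, (closedBall ζ (2 ^ k * h)).indicator
        (fun _ ↦ ENNReal.ofReal (16 / (4 ^ k * h ^ 2))) η := by
    have h1 : h ≤ ‖(η : ℂ) - r * ζ‖ := by
      have := one_sub_norm_le_norm_sub η (r * ζ)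
      rwa [norm_smul_circle hr0] at this
    have h2 := norm_sub_le_two_mul_norm_sub_smul η ζ hr0 hr.le
    -- Take the first dyadic scale reaching η; being minimal, it is at most 2|η - ζ| ≤ 4|η - rζ|, or
    -- equal to h itself.
    obtain ⟨k, hk1, hk2⟩ : ∃ k : ℕ, ‖(η : ℂ) - ζ‖ ≤ 2 ^ k * h ∧
        2 ^ k * h ≤ 4 * ‖(η : ℂ) - r * ζ‖ := by
      rcases le_or_gt ‖(η : ℂ) - ζ‖ h with h3 | h3
      · exact ⟨0, by simpa using h3, by simp; linarith⟩
      · obtain ⟨n, hn1, hn2⟩ := exists_nat_pow_near (x := ‖(η : ℂ) - ζ‖ / h) (y := 2)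
          (by rw [le_div_iff₀ h0]; linarith) (by norm_num)
        rw [le_div_iff₀ h0] at hn1
        rw [div_lt_iff₀ h0] at hn2
        refine ⟨n + 1, hn2.le, ?_⟩
        rw [pow_succ]
        linarith
    refine le_trans ?_ (ENNReal.le_tsum k)
    rw [indicator_of_mem (by rw [mem_closedBall, Circle.dist_eq_norm]; exact hk1), ← ofReal_norm,
      ← ENNReal.ofReal_pow (norm_nonneg _),
      ← ENNReal.ofReal_inv_of_pos (pow_pos (h0.trans_le h1) 2)]
    apply ENNReal.ofReal_le_ofReal
    have hpos : 0 < ‖(η : ℂ) - r * ζ‖ := h0.trans_le h1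
    rw [inv_eq_one_div, div_le_div_iff₀ (by positivity) (by positivity)]
    have h4 : (2 ^ k * h) ^ 2 ≤ (4 * ‖(η : ℂ) - r * ζ‖) ^ 2 := by gcongr
    have h5 : (4 : ℝ) ^ k = (2 ^ k) ^ 2 := by rw [← pow_mul, mul_comm, pow_mul]; norm_num
    rw [h5]
    nlinarith
  have hsum : inverseSquarePotential m (r * ζ) ≤ ENNReal.ofReal (32 / h) * B := by
    calc inverseSquarePotential m (r * ζ)
        ≤ ∫⁻ η, ∑' k : ℕ, (closedBall ζ (2 ^ k * h)).indicator
          (fun _ ↦ ENNReal.ofReal (16 / (4 ^ k * h ^ 2))) η ∂m := lintegral_mono hpt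
      _ = ∑' k : ℕ, ENNReal.ofReal (16 / (4 ^ k * h ^ 2)) * m (closedBall ζ (2 ^ k * h)) := by
          rw [lintegral_tsum fun k ↦
            (measurable_const.indicator measurableSet_closedBall).aemeasurable]
          congr 1
          ext k
          rw [lintegral_indicator_const measurableSet_closedBall]
      _ ≤ ∑' k : ℕ, ENNReal.ofReal (16 / h) * B * 2⁻¹ ^ k := by
          refine ENNReal.tsum_le_tsum fun k ↦ ?_
          calc _ ≤ ENNReal.ofReal (16 / (4 ^ k * h ^ 2)) * (B * ENNReal.ofReal (2 ^ k * h)) := by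
                gcongr
                exact hB _ (by positivity)
            _ = ENNReal.ofReal (16 / (4 ^ k * h ^ 2) * (2 ^ k * h)) * B := by
                rw [ENNReal.ofReal_mul (p := 16 / (4 ^ k * h ^ 2)) (by positivity)]
                ring
            _ = ENNReal.ofReal (16 / h * 2⁻¹ ^ k) * B := by
                congr 2
                have h5 : (4 : ℝ) ^ k = (2 ^ k) ^ 2 := by
                  rw [← pow_mul, mul_comm, pow_mul]
                  norm_num
                rw [h5, inv_pow]
                field_simp
            _ = _ := by
                rw [ENNReal.ofReal_mul (by positivity), ENNReal.ofReal_pow (by norm_num),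
                  ENNReal.ofReal_inv_of_pos (by norm_num), ENNReal.ofReal_ofNat]
                ring
      _ = _ := by
          rw [ENNReal.tsum_mul_left, ENNReal.tsum_geometric, ENNReal.one_sub_inv_two, inv_inv,
            mul_right_comm, show (2 : ℝ≥0∞) = ENNReal.ofReal 2 by simp,
            ← ENNReal.ofReal_mul (by positivity)]
          congr 2
          ring
  calc _ ≤ ENNReal.ofReal (2 * h) * (ENNReal.ofReal (32 / h) * B) := by
        gcongr
        nlinarith
    _ = 64 * B := by
        rw [← mul_assoc, ← ENNReal.ofReal_mul (by positivity)]
        congr 1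
        rw [show 2 * h * (32 / h) = 64 by field_simp; norm_num, ENNReal.ofReal_ofNat]

theorem exists_closedBall_le_of_tendsto {m : Measure Circle} [IsFiniteMeasure m] {ζ : Circle}
    {L L' : ℝ≥0∞} (hL' : L < L')
    (h : Tendsto (fun h ↦ m (closedBall ζ h) / circleArcLength (closedBall ζ h)) (𝓝[>] 0) (𝓝 L)) :
    ∃ δ > (0 : ℝ), ∀ h : ℝ, 0 < h → h ≤ δ →
      m (closedBall ζ h) ≤ L' * ENNReal.ofReal π * ENNReal.ofReal h := by
  obtain ⟨ε, hε, h2⟩ := (mem_nhdsGT_iff_exists_Ioo_subset).1 (h.eventually_lt_const hL')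
  rw [mem_Ioi] at hε
  refine ⟨min (ε / 2) 1, by positivity, fun t ht0 ht ↦ ?_⟩
  have h3 := h2 (show t ∈ Ioo 0 ε from ⟨ht0, by linarith [ht.trans (min_le_left _ _)]⟩)
  have h4 : circleArcLength (closedBall ζ t) ≠ 0 := by
    have := le_circleArcLength_closedBall ζ (ht.trans (min_le_right _ _))
    intro h'
    rw [h', nonpos_iff_eq_zero, ENNReal.ofReal_eq_zero] at this
    linarith
  calc m (closedBall ζ t) ≤ L' * circleArcLength (closedBall ζ t) :=
        ((ENNReal.div_lt_iff (Or.inl h4) (Or.inl (measure_ne_top _ _))).1 h3).le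
    _ ≤ L' * ENNReal.ofReal (π * t) := by
        gcongr
        exact circleArcLength_closedBall_le ζ t
    _ = _ := by rw [ENNReal.ofReal_mul (by positivity), mul_assoc]

/-- Finiteness of the maximal function: small radii are controlled by the finite derivative of m,
larger ones by the total mass. -/
theorem ae_exists_closedBall_le (m : Measure Circle) [IsFiniteMeasure m] :
    ∀ᵐ ζ ∂circleArcLength, ∃ B : ℝ≥0∞, B < ∞ ∧
      ∀ h : ℝ, 0 < h → m (closedBall ζ h) ≤ B * ENNReal.ofReal h := by
  filter_upwards [ae_exists_tendsto_closedBall_div m circleArcLength] with ζ ⟨L, hL, hlim⟩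
  obtain ⟨δ, hδ, h1⟩ := exists_closedBall_le_of_tendsto
    (ENNReal.lt_add_right hL.ne one_ne_zero) hlim
  refine ⟨(L + 1) * ENNReal.ofReal π + m univ / ENNReal.ofReal δ, ?_, fun h h0 ↦ ?_⟩
  · refine ENNReal.add_lt_top.2 ⟨ENNReal.mul_lt_top (by simpa using hL) ENNReal.ofReal_lt_top,
      ENNReal.div_lt_top (measure_ne_top _ _) (by simpa using hδ)⟩
  · rw [add_mul]
    rcases le_or_gt h δ with hle | hgt
    · exact (h1 h h0 hle).trans le_self_add
    · refine le_trans ?_ le_add_self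
      calc m (closedBall ζ h) ≤ m univ := measure_mono (subset_univ _)
        _ = m univ / ENNReal.ofReal δ * ENNReal.ofReal δ :=
          (ENNReal.div_mul_cancel (by simpa using hδ) ENNReal.ofReal_ne_top).symm
        _ ≤ _ := by gcongr

/-- Near ζ the mass satisfies the ball bound with an arbitrarily small constant, so the maximal
estimate applies; the rest of μ has finite potential at ζ and is killed by the factor 1 - r². -/
theorem tendsto_poisson_radial_zero {μ : Measure Circle} [IsFiniteMeasure μ] {ζ : Circle}
    (h : Tendsto (fun h ↦ μ (closedBall ζ h) / circleArcLength (closedBall ζ h)) (𝓝[>] 0) (𝓝 0)) :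
    Tendsto (fun r : ℝ ↦ ENNReal.ofReal (1 - r ^ 2) * inverseSquarePotential μ (r * ζ))
      (𝓝[<] 1) (𝓝 0) := by
  rw [ENNReal.tendsto_nhds_zero]
  intro ε hε
  obtain ⟨η, hη0, hη⟩ : ∃ η : ℝ≥0∞, 0 < η ∧ 64 * (η * ENNReal.ofReal π) ≤ ε / 2 := by
    refine ⟨ε / 2 / (64 * ENNReal.ofReal π), ?_, ?_⟩
    · exact ENNReal.div_pos (ENNReal.half_pos hε.ne').ne'
        (ENNReal.mul_ne_top (by simp) ENNReal.ofReal_ne_top)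
    · rw [mul_left_comm, ENNReal.div_mul_cancel]
      · simp [Real.pi_pos]
      · exact ENNReal.mul_ne_top (by simp) ENNReal.ofReal_ne_top
  obtain ⟨δ, hδ, h1⟩ := exists_closedBall_le_of_tendsto hη0 h
  set μ₁ := μ.restrict (closedBall ζ δ)
  set μ₂ := μ.restrict (closedBall ζ δ)ᶜ
  have hμ₁ (t : ℝ) (ht : 0 < t) : μ₁ (closedBall ζ t) ≤ η * ENNReal.ofReal π * ENNReal.ofReal t := by
    rcases le_or_gt t δ with hle | hgt
    · exact (Measure.restrict_apply_le _ _).trans (h1 t ht hle)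
    · calc μ₁ (closedBall ζ t) ≤ μ (closedBall ζ δ) := by
            rw [Measure.restrict_apply measurableSet_closedBall]
            exact measure_mono inter_subset_right
        _ ≤ η * ENNReal.ofReal π * ENNReal.ofReal δ := h1 δ hδ le_rfl
        _ ≤ _ := by gcongr
  have hμ₂ : inverseSquarePotential μ₂ ζ < ∞ := by
    refine inverseSquarePotential_lt_top_of_notMem (E := (ball ζ δ)ᶜ) isOpen_ball.isClosed_compl ?_
      (by simpa using hδ)
    rw [compl_compl, Measure.restrict_apply isOpen_ball.measurableSet]
    refine measure_mono_null (fun x hx ↦ ?_) measure_empty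
    exact hx.2 (ball_subset_closedBall hx.1)
  have hsplit (z : ℂ) : inverseSquarePotential μ z =
      inverseSquarePotential μ₁ z + inverseSquarePotential μ₂ z :=
    (lintegral_add_compl _ measurableSet_closedBall).symm
  have hlim : Tendsto (fun r : ℝ ↦ ENNReal.ofReal (1 - r ^ 2) * (4 * inverseSquarePotential μ₂ ζ))
      (𝓝[<] 1) (𝓝 0) := by
    have hc : Continuous fun r : ℝ ↦ ENNReal.ofReal (1 - r ^ 2) :=
      ENNReal.continuous_ofReal.comp (by fun_prop)
    have h2 := ENNReal.Tendsto.mul_const (b := 4 * inverseSquarePotential μ₂ ζ) (hc.tendsto 1)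
      (Or.inr (ENNReal.mul_ne_top (by simp) hμ₂.ne))
    simpa using h2.mono_left nhdsWithin_le_nhds
  filter_upwards [(ENNReal.tendsto_nhds_zero.1 hlim) (ε / 2) (ENNReal.half_pos hε.ne'),
    Ioo_mem_nhdsLT (show (0 : ℝ) < 1 by norm_num)] with r hr1 hr
  rw [hsplit, mul_add, ← ENNReal.add_halves ε]
  refine add_le_add ?_ ?_
  · exact (inverseSquarePotential_smul_le_of_closedBall_le hμ₁ hr.1.le hr.2).trans hη
  · refine le_trans ?_ hr1
    gcongr
    exact inverseSquarePotential_smul_le μ₂ ζ hr.1.le hr.2.le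

theorem tendsto_norm_singularInner_radial {μ : Measure Circle} [IsFiniteMeasure μ] {ζ : Circle}
    (h : Tendsto (fun r : ℝ ↦ ENNReal.ofReal (1 - r ^ 2) * inverseSquarePotential μ (r * ζ))
      (𝓝[<] 1) (𝓝 0)) :
    Tendsto (fun r : ℝ ↦ ‖singularInner μ (r * ζ)‖) (𝓝[<] 1) (𝓝 1) := by
  have h1 := (Real.continuous_exp.tendsto _).comp
    ((ENNReal.tendsto_toReal ENNReal.zero_ne_top).comp h).neg
  rw [ENNReal.toReal_zero, neg_zero, Real.exp_zero] at h1
  refine h1.congr' ?_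
  filter_upwards [Ioo_mem_nhdsLT (show (0 : ℝ) < 1 by norm_num)] with r hr
  have hn := norm_smul_circle hr.1.le ζ
  rw [norm_singularInner μ (by rw [hn]; exact hr.2), hn]
  simp only [Function.comp_apply, ENNReal.toReal_mul]
  rw [ENNReal.toReal_ofReal (by nlinarith [hr.1, hr.2])]

/-! ### From a derivative in the Hardy space back to integrability of V^p. -/

theorem inverseSquarePotential_le_liminf (μ : Measure Circle) (ζ : Circle) {R : ℕ → ℝ}
    (hR : Tendsto R atTop (𝓝 1)) :
    inverseSquarePotential μ ζ ≤ liminf (fun n ↦ inverseSquarePotential μ (R n * ζ)) atTop := by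
  refine le_trans (le_of_eq ?_) (lintegral_liminf_le fun n ↦ by fun_prop)
  refine lintegral_congr fun ξ ↦ (Tendsto.liminf_eq ?_).symm
  have hc : Continuous fun r : ℝ ↦ (‖(ξ : ℂ) - r * ζ‖ₑ ^ 2)⁻¹ :=
    ((ENNReal.continuous_pow 2).comp (by fun_prop)).inv
  have h := (hc.tendsto 1).comp hR
  rwa [Complex.ofReal_one, one_mul] at h

/-- Integrating the derivative from the boundary gives 1 - |S_μ(rζ)| ≤ M(1 - r). The left side is 1
- e^(-u) with u = (1 - r²)V(rζ), so V(rζ) stays bounded as r → 1, and Fatou's lemma gives the value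
at ζ. -/
theorem inverseSquarePotential_lt_top_of_bounded_deriv {μ : Measure Circle} [IsFiniteMeasure μ]
    {ζ : Circle} {M : ℝ}
    (hM : ∀ r ∈ Ico (0 : ℝ) 1, ‖deriv (singularInner μ) (r * ζ)‖ ≤ M)
    (hS : Tendsto (fun r : ℝ ↦ ‖singularInner μ (r * ζ)‖) (𝓝[<] 1) (𝓝 1)) :
    inverseSquarePotential μ ζ < ∞ := by
  have hM0 : 0 ≤ M := (norm_nonneg _).trans (hM 0 ⟨le_rfl, one_pos⟩)
  have hball {r : ℝ} (hr : r ∈ Ico (0 : ℝ) 1) : ‖(r : ℂ) * ζ‖ < 1 := by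
    rw [norm_smul_circle hr.1]
    exact hr.2
  have hlip : ∀ r ∈ Ico (0 : ℝ) 1, ∀ s ∈ Ico (0 : ℝ) 1,
      ‖singularInner μ (s * ζ) - singularInner μ (r * ζ)‖ ≤ M * ‖s - r‖ := by
    intro r hr s hs
    refine (convex_Ico (0 : ℝ) 1).norm_image_sub_le_of_norm_hasDerivWithin_le
      (f := fun t : ℝ ↦ singularInner μ (t * ζ))
      (f' := fun t : ℝ ↦ deriv (singularInner μ) (t * ζ) * ζ) (fun t ht ↦ ?_) (fun t ht ↦ ?_) hr hs
    · have h1 := (hasDerivAt_singularInner μ (hball ht)).differentiableAt.hasDerivAt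
      have h2 : HasDerivAt (fun t : ℂ ↦ t * (ζ : ℂ)) ζ (t : ℂ) := by
        simpa using (hasDerivAt_id (t : ℂ)).mul_const (ζ : ℂ)
      exact (HasDerivAt.comp (t : ℂ) h1 h2).comp_ofReal.hasDerivWithinAt
    · rw [norm_mul, Circle.norm_coe, mul_one]
      exact hM t ht
  have hle : ∀ r ∈ Ico (0 : ℝ) 1, 1 - ‖singularInner μ (r * ζ)‖ ≤ M * (1 - r) := by
    intro r hr
    have h1 : Tendsto (fun s : ℝ ↦ ‖singularInner μ (s * ζ)‖ - ‖singularInner μ (r * ζ)‖)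
        (𝓝[<] 1) (𝓝 (1 - ‖singularInner μ (r * ζ)‖)) := hS.sub_const _
    refine le_of_tendsto h1 ?_
    filter_upwards [Ioo_mem_nhdsLT hr.2] with s hs
    refine (norm_sub_norm_le _ _).trans ((hlip r hr s ⟨hr.1.trans hs.1.le, hs.2⟩).trans ?_)
    gcongr
    rw [Real.norm_of_nonneg (by linarith [hs.1])]
    linarith [hs.2]
  have hV : ∀ᶠ r : ℝ in 𝓝[<] 1, inverseSquarePotential μ (r * ζ) ≤ ENNReal.ofReal (2 * M) := by
    have h1 : Tendsto (fun r : ℝ ↦ M * (1 - r)) (𝓝[<] 1) (𝓝 0) := by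
      have hc : Continuous fun r : ℝ ↦ M * (1 - r) := by fun_prop
      simpa using (hc.tendsto 1).mono_left nhdsWithin_le_nhds
    filter_upwards [h1.eventually_le_const (show (0 : ℝ) < 1 / 2 by norm_num),
      Ioo_mem_nhdsLT (show (0 : ℝ) < 1 by norm_num)] with r hr1 hr
    have hr' : r ∈ Ico (0 : ℝ) 1 := ⟨hr.1.le, hr.2⟩
    have h2 := hle r hr'
    rw [norm_singularInner μ (hball hr'), norm_smul_circle hr.1.le] at h2
    rw [← ENNReal.ofReal_toReal (inverseSquarePotential_lt_top μ (hball hr')).ne]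
    apply ENNReal.ofReal_le_ofReal
    set v := (inverseSquarePotential μ (r * ζ)).toReal
    have hv : 0 ≤ v := ENNReal.toReal_nonneg
    set u := (1 - r ^ 2) * v with hu
    have hu0 : 0 ≤ u := mul_nonneg (by nlinarith [hr.1, hr.2]) hv
    have h3 := Real.add_one_le_exp u
    have h4 : Real.exp (-u) * Real.exp u = 1 := by rw [← Real.exp_add]; simp
    have h5 : (1 - M * (1 - r)) * (u + 1) ≤ 1 := by
      refine le_trans ?_ h4.le
      gcongr
      linarith
    have h6 : u ≤ 2 * (M * (1 - r)) := by nlinarith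
    have h7 : (1 - r) * v ≤ u := by
      rw [hu]
      gcongr
      nlinarith [hr.1, hr.2]
    have h8 : 0 < 1 - r := by linarith [hr.2]
    nlinarith
  refine lt_of_le_of_lt ((inverseSquarePotential_le_liminf μ ζ
    (tendsto_one_sub_one_div_add_two.mono_right nhdsWithin_le_nhds)).trans ?_)
    (ENNReal.ofReal_lt_top (r := 2 * M))
  have hV' : ∀ᶠ n : ℕ in atTop, inverseSquarePotential μ ((1 - 1 / ((n : ℝ) + 2) : ℝ) * ζ) ≤
      ENNReal.ofReal (2 * M) := tendsto_one_sub_one_div_add_two.eventually hV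
  exact (liminf_le_liminf hV').trans (liminf_const _).le

theorem MemHardy.ae_potential_lt_top {p : ℝ} (hp0 : 0 < p) {μ : Measure Circle}
    [IsFiniteMeasure μ] (hs : μ ⟂ₘ circleArcLength) (hμ : MemHardy p (deriv (singularInner μ))) :
    ∀ᵐ ζ : Circle ∂circleArcLength, inverseSquarePotential μ ζ < ∞ := by
  obtain ⟨m, hm, hmaj⟩ := hμ.exists_measure_majorant hp0
  filter_upwards [ae_exists_closedBall_le m, ae_tendsto_closedBall_div_zero hs]
    with ζ ⟨B, hB, hball⟩ hζ
  refine inverseSquarePotential_lt_top_of_bounded_deriv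
    (M := ((64 * B).toReal) ^ p⁻¹) (fun r hr ↦ ?_)
    (tendsto_norm_singularInner_radial (tendsto_poisson_radial_zero hζ))
  have hn := norm_smul_circle hr.1 ζ
  have h1 := hmaj (r * ζ) (by rw [hn]; exact hr.2)
  rw [hn] at h1
  have h2 := h1.trans (inverseSquarePotential_smul_le_of_closedBall_le hball hr.1 hr.2)
  rw [ENNReal.ofReal_le_iff_le_toReal (ENNReal.mul_ne_top (by simp) hB.ne)] at h2
  rwa [Real.le_rpow_inv_iff_of_pos (norm_nonneg _) ENNReal.toReal_nonneg hp0]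

/-- The argument of the kernel depends on ζ only, so no cancellation occurs in the boundary integral
for the derivative. For ξ = ζ both sides are 0, by division by zero. -/
theorem Circle.two_mul_div_sub_sq (ξ ζ : Circle) :
    2 * (ξ : ℂ) / (ξ - ζ) ^ 2 = -(2 / (ζ : ℂ)) * (((‖(ξ : ℂ) - ζ‖ ^ 2)⁻¹ : ℝ) : ℂ) := by
  by_cases h : (ξ : ℂ) = ζ
  · simp [h]
  have h1 : (ξ : ℂ) - ζ ≠ 0 := sub_ne_zero.2 h
  have h2 : (ξ : ℂ) ≠ 0 := ξ.coe_ne_zero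
  have h3 : (ζ : ℂ) ≠ 0 := ζ.coe_ne_zero
  have h4 : ((‖(ξ : ℂ) - ζ‖ ^ 2 : ℝ) : ℂ) = -((ξ : ℂ) - ζ) ^ 2 / (ξ * ζ) := by
    rw [← Complex.normSq_eq_norm_sq, Complex.normSq_eq_conj_mul_self, map_sub,
      ← Circle.coe_inv_eq_conj, ← Circle.coe_inv_eq_conj, Circle.coe_inv, Circle.coe_inv]
    field_simp
    ring
  rw [Complex.ofReal_inv, h4]
  field_simp

/-- Dominated convergence along the radius, with the integrable bound 8|ξ - ζ|⁻², handles the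
integral factor; |S_μ| → 1 because (1 - r²)V(rζ) ≤ 4(1 - r²)V(ζ). -/
theorem tendsto_enorm_deriv_singularInner {μ : Measure Circle} [IsFiniteMeasure μ] {ζ : Circle}
    (hV : inverseSquarePotential μ ζ < ∞) {R : ℕ → ℝ} (hR : ∀ n, R n ∈ Ico (0 : ℝ) 1)
    (hR1 : Tendsto R atTop (𝓝[<] 1)) :
    Tendsto (fun n ↦ ‖deriv (singularInner μ) (R n * ζ)‖ₑ) atTop
      (𝓝 (2 * inverseSquarePotential μ ζ)) := by
  have hball (n : ℕ) : ‖(R n : ℂ) * ζ‖ < 1 := by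
    rw [norm_smul_circle (hR n).1]
    exact (hR n).2
  have hR' : Tendsto R atTop (𝓝 1) := hR1.mono_right nhdsWithin_le_nhds
  have hne : ∀ᵐ ξ : Circle ∂μ, (ξ : ℂ) ≠ ζ := by
    filter_upwards [ae_lt_top (by fun_prop) hV.ne] with ξ hξ h
    simp [h] at hξ
  have hint : Integrable (fun ξ : Circle ↦ (‖(ξ : ℂ) - ζ‖ ^ 2)⁻¹) μ ∧
      ENNReal.ofReal (∫ ξ : Circle, (‖(ξ : ℂ) - ζ‖ ^ 2)⁻¹ ∂μ) = inverseSquarePotential μ ζ := by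
    have he : ∫⁻ ξ : Circle, ENNReal.ofReal ((‖(ξ : ℂ) - ζ‖ ^ 2)⁻¹) ∂μ =
        inverseSquarePotential μ ζ := by
      refine lintegral_congr_ae ?_
      filter_upwards [hne] with ξ hξ
      have : 0 < ‖(ξ : ℂ) - ζ‖ := norm_pos_iff.2 (sub_ne_zero.2 hξ)
      rw [ENNReal.ofReal_inv_of_pos (by positivity), ENNReal.ofReal_pow (norm_nonneg _),
        ofReal_norm]
    have hi : Integrable (fun ξ : Circle ↦ (‖(ξ : ℂ) - ζ‖ ^ 2)⁻¹) μ := by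
      refine ⟨(by fun_prop : Measurable fun ξ : Circle ↦
        (‖(ξ : ℂ) - ζ‖ ^ 2)⁻¹).aestronglyMeasurable, ?_⟩
      rw [hasFiniteIntegral_iff_ofReal (ae_of_all _ fun ξ ↦ by positivity), he]
      exact hV
    exact ⟨hi, by rw [ofReal_integral_eq_lintegral_ofReal hi (ae_of_all _ fun ξ ↦ by positivity), he]⟩
  have hlim : Tendsto (fun n ↦ ∫ ξ : Circle, 2 * (ξ : ℂ) / (ξ - R n * ζ) ^ 2 ∂μ) atTop
      (𝓝 (∫ ξ : Circle, 2 * (ξ : ℂ) / (ξ - ζ) ^ 2 ∂μ)) := by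
    refine tendsto_integral_of_dominated_convergence (fun ξ : Circle ↦ 8 * (‖(ξ : ℂ) - ζ‖ ^ 2)⁻¹)
      (fun n ↦ ?_) (hint.1.const_mul 8) (fun n ↦ ?_) ?_
    · refine Continuous.aestronglyMeasurable (Continuous.div (by fun_prop) (by fun_prop) fun ξ ↦ ?_)
      exact pow_ne_zero _ (ξ.sub_ne_zero_of_norm_lt_one (hball n))
    · filter_upwards [hne] with ξ hξ
      have h0 : 0 < ‖(ξ : ℂ) - ζ‖ := norm_pos_iff.2 (sub_ne_zero.2 hξ)
      have h1 := norm_sub_le_two_mul_norm_sub_smul ξ ζ (hR n).1 (hR n).2.le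
      have h2 : 0 < ‖(ξ : ℂ) - R n * ζ‖ := by linarith
      simp only [norm_div, norm_mul, norm_pow, Circle.norm_coe, Complex.norm_ofNat, mul_one]
      rw [← div_eq_mul_inv, div_le_div_iff₀ (by positivity) (by positivity)]
      nlinarith
    · filter_upwards [hne] with ξ hξ
      have h1 : Tendsto (fun n ↦ (ξ : ℂ) - R n * ζ) atTop (𝓝 ((ξ : ℂ) - ζ)) := by
        have := (((Complex.continuous_ofReal.tendsto 1).comp hR').mul_const (ζ : ℂ)).const_sub (ξ : ℂ)
        simpa using this
      exact tendsto_const_nhds.div (h1.pow 2) (pow_ne_zero _ (sub_ne_zero.2 hξ))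
  have hval : ‖∫ ξ : Circle, 2 * (ξ : ℂ) / (ξ - ζ) ^ 2 ∂μ‖ₑ = 2 * inverseSquarePotential μ ζ := by
    simp_rw [Circle.two_mul_div_sub_sq]
    rw [integral_const_mul, integral_complex_ofReal, ← hint.2, ← ofReal_norm, norm_mul, norm_neg,
      norm_div, Circle.norm_coe, Complex.norm_real,
      Real.norm_of_nonneg (integral_nonneg fun ξ ↦ by positivity), ENNReal.ofReal_mul (by positivity)]
    simp
  have hS : Tendsto (fun n ↦ ‖singularInner μ (R n * ζ)‖ₑ) atTop (𝓝 1) := by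
    have h1 : Tendsto (fun r : ℝ ↦ ENNReal.ofReal (1 - r ^ 2) * inverseSquarePotential μ (r * ζ))
        (𝓝[<] 1) (𝓝 0) := by
      have hc : Continuous fun r : ℝ ↦ ENNReal.ofReal (1 - r ^ 2) :=
      ENNReal.continuous_ofReal.comp (by fun_prop)
      have h2 := ENNReal.Tendsto.mul_const (b := 4 * inverseSquarePotential μ ζ) (hc.tendsto 1)
        (Or.inr (ENNReal.mul_ne_top (by simp) hV.ne))
      have h3 := h2.mono_left (nhdsWithin_le_nhds (s := Iio 1))
      rw [one_pow, sub_self, ENNReal.ofReal_zero, zero_mul] at h3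
      refine tendsto_of_tendsto_of_tendsto_of_le_of_le' tendsto_const_nhds h3
        (Eventually.of_forall fun _ ↦ zero_le) ?_
      filter_upwards [Ioo_mem_nhdsLT (show (0 : ℝ) < 1 by norm_num)] with r hr
      gcongr
      exact inverseSquarePotential_smul_le μ ζ hr.1.le hr.2.le
    have h4 := (ENNReal.continuous_ofReal.tendsto 1).comp
      ((tendsto_norm_singularInner_radial h1).comp hR1)
    simpa [Function.comp_def] using h4
  have hprod := ENNReal.Tendsto.mul hS (Or.inl one_ne_zero)
    ((continuous_enorm.tendsto _).comp hlim) (Or.inr ENNReal.one_ne_top)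
  rw [one_mul, hval] at hprod
  refine hprod.congr fun n ↦ ?_
  rw [(hasDerivAt_singularInner μ (hball n)).deriv, enorm_neg, enorm_mul, Function.comp_apply]

theorem MemHardy.areaCondition {p : ℝ} (hp0 : 0 < p) {μ : Measure Circle}
    [IsFiniteMeasure μ] (hs : μ ⟂ₘ circleArcLength) (hμ : MemHardy p (deriv (singularInner μ))) :
    AreaCondition (1 + p) μ := by
  refine areaCondition_of_lintegral_potential_lt_top hp0 μ ?_
  let R : ℕ → ℝ := fun n ↦ 1 - 1 / ((n : ℝ) + 2)
  have hR (n : ℕ) : R n ∈ Ico (0 : ℝ) 1 := one_sub_one_div_add_two_mem n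
  have hcont (n : ℕ) : Continuous fun ζ : Circle ↦ deriv (singularInner μ) (R n * ζ) :=
    hμ.1.continuousOn.comp_continuous (by fun_prop) fun ζ ↦ by
      rw [mem_ball_zero_iff, norm_smul_circle (hR n).1]
      exact (hR n).2
  refine lt_of_le_of_lt ?_ hμ.2
  calc ∫⁻ ζ : Circle, inverseSquarePotential μ ζ ^ p ∂circleArcLength
      ≤ ∫⁻ ζ : Circle, liminf (fun n ↦ ‖deriv (singularInner μ) (R n * ζ)‖ₑ ^ p) atTop
          ∂circleArcLength := by
        refine lintegral_mono_ae ?_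
        filter_upwards [hμ.ae_potential_lt_top hp0 hs] with ζ hζ
        have h1 := ((ENNReal.continuous_rpow_const (y := p)).tendsto _).comp
          (tendsto_enorm_deriv_singularInner hζ hR tendsto_one_sub_one_div_add_two)
        refine le_trans ?_ h1.liminf_eq.ge
        gcongr
        exact le_mul_of_one_le_left zero_le (by norm_num)
    _ ≤ liminf (fun n ↦ ∫⁻ ζ : Circle, ‖deriv (singularInner μ) (R n * ζ)‖ₑ ^ p
          ∂circleArcLength) atTop :=
        lintegral_liminf_le fun n ↦ (hcont n).measurable.enorm.pow_const p
    _ ≤ _ := by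
        refine (liminf_le_liminf (Eventually.of_forall fun n ↦ ?_)).trans
          (liminf_const (f := atTop (α := ℕ)) _).le
        exact le_iSup (fun r : Ico (0 : ℝ) 1 ↦ ∫⁻ ζ : Circle,
          ‖deriv (singularInner μ) ((r : ℝ) * (ζ : ℂ))‖ₑ ^ p ∂circleArcLength) ⟨R n, hR n⟩

/-! ### The theorem. -/

theorem mainTheorem8 (p : ℝ) (hp0 : 0 < p) (hp : p < 1 / 2) :
    (∀ (μ : Measure Circle) [IsFiniteMeasure μ] (E : Set Circle),
      IsBeurlingCarleson (1 - p) E → μ Eᶜ = 0 →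
      AreaCondition (1 + p) μ → MemHardy p (deriv (singularInner μ))) ∧
    (∀ (μ : Measure Circle) [IsFiniteMeasure μ], μ ⟂ₘ circleArcLength →
      (UpToCountableSums (AreaCondition (1 + p)) μ ↔
        UpToCountableSums (fun ν => MemHardy p (deriv (singularInner ν))) μ)) := by
  have hp1 : p < 1 := by linarith
  refine ⟨fun μ _ E hE hμ hA ↦ memHardy_deriv_of_lintegral_potential_lt_top hp0 μ
    (lintegral_potential_lt_top_of_isBeurlingCarleson hp0 hp1 μ hE hμ hA), fun μ _ hs ↦ ⟨?_, ?_⟩⟩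
  -- Each summand is dominated by μ and hence singular, so it can be cut separately and the double
  -- sum reindexed.
  · rintro ⟨ν, hν, hsum⟩
    refine UpToCountableSums.bind hsum fun k ↦ ?_
    have := (hν k).1
    refine (hν k).2.upToCountableSums_memHardy hp0 hp1 (hs.mono_ac ?_ .rfl)
    rw [hsum]
    exact (Measure.le_sum ν k).absolutelyContinuous
  · rintro ⟨ν, hν, hsum⟩
    refine ⟨ν, fun k ↦ ⟨(hν k).1, ?_⟩, hsum⟩
    have := (hν k).1
    refine (hν k).2.areaCondition hp0 (hs.mono_ac ?_ .rfl)
    rw [hsum]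
    exact (Measure.le_sum ν k).absolutelyContinuous
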